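/- Let $\mathcal H_1,\mathcal H_2$ be separable complex Hilbert spaces (inner products linear in the first variable), $U$ and $V$ unitary operators on $\mathcal H_1$ and $\mathcal H_2$, and $\mathcal H_1\otimes\mathcal H_2$ the Hilbert space tensor product. Let $a\in\mathcal H_1$ be such that $\{U^na\}_{n\in\mathbb Z}$ is a Riesz sequence (the image of an orthonormal basis of its closed span under a bounded, boundedly invertible operator), and let $b\in\mathcal H_2$ and $N\ge 1$ be such that $V^Nb=b$ and $b,Vb,\dots,V^{N-1}b$ are linearly independent. Put $$\mathcal A_{a,b}:=\overline{\operatorname{span}}\{U^na\otimes V^pb : n\in\mathbb Z,\ 0\le p\le N-1\}\subseteq\mathcal H_1\otimes\mathcal H_2 .$$ Let $r\ge 1$, let $\bar r$ be a divisor of $N$ and $\ell:=N/\bar r$. Fix $h_{j1}\in\mathcal H_1$ $(1\le j\le s)$ and $h_{j'2}\in\mathcal H_2$ $(1\le j'\le s')$, and for $x\in\mathcal A_{a,b}$ define the samples $$\mathcal L_{jj'}x(rn,\bar rm):=\langle x,\,U^{rn}h_{j1}\otimes V^{\bar rm}h_{j'2}\rangle,\qquad n\in\mathbb Z,\ 0\le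 m\le\ell-1 .$$ Let $g_j(x):=\sum_{k\in\mathbb Z}\langle a,U^kh_{j1}\rangle e^{2\pi ikx}\in L^2(0,1)$, extended $1$-periodically, let $\mathbf G(x):=\big(g_j(x+\tfrac{k-1}{r})\big)_{1\le j\le s,\,1\le k\le r}$, and $$\alpha_{\mathbf G}:=\operatorname*{ess\,inf}_{x\in(0,1/r)}\lambda_{\min}[\mathbf G^*(x)\mathbf G(x)],\qquad \beta_{\mathbf G}:=\operatorname*{ess\,sup}_{x\in(0,1/r)}\lambda_{\max}[\mathbf G^*(x)\mathbf G(x)]\in[0,\infty].$$ Let $\mathbf R_{b,h_2}$ be the $s'\ell\times N$ matrix whose row with index $(j',m)$, $1\le j'\le s'$, $0\le m\le\ell-1$, is $\big(\langle V^{N-\bar rm+p}b,h_{j'2}\rangle\big)_{p=0}^{N-1}$. Then $g_j\in L^\infty(0,1)$ for all $j$ if and only if $\beta_{\mathbf G}<\infty$. If this holds, the following statements are equivalent: (a) $\alpha_{\mathbf G}>0$ and $\operatorname{rank}\mathbf R_{b,h_2}=N$. (b) There exist $ss'$ elements $c_j\otimes d_{j'}\in\mathcal A_{a,b}$ $(c_j\in\mathcal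 H_1,\ d_{j'}\in\mathcal H_2)$ such that $\{(U^{rn}\otimes V^{\bar rm})(c_j\otimes d_{j'})\}_{j,j',n,m}$, with $1\le j\le s$, $1\le j'\le s'$, $n\in\mathbb Z$, $0\le m\le \ell-1$, is a frame for $\mathcal A_{a,b}$ and, for every $x\in\mathcal A_{a,b}$, $$x=\sum_{j=1}^s\sum_{j'=1}^{s'}\sum_{n\in\mathbb Z}\sum_{m=0}^{\ell-1}\mathcal L_{jj'}x(rn,\bar rm)\,(U^{rn}\otimes V^{\bar rm})(c_j\otimes d_{j'}),$$ with unconditional convergence in $\mathcal H_1\otimes\mathcal H_2$. (c) There exists a frame $\{C_{j,j',n,m}\}_{j,j',n,m}$ for $\mathcal A_{a,b}$, with the same index set, such that, for every $x\in\mathcal A_{a,b}$, $$x=\sum_{j=1}^s\sum_{j'=1}^{s'}\sum_{n\in\mathbb Z}\sum_{m=0}^{\ell-1}\mathcal L_{jj'}x(rn,\bar rm)\,C_{j,j',n,m},$$ with unconditional convergence in $\mathcal H_1\otimes\mathcal H_2$. -/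

import Mathlib

open MeasureTheory
open scoped TensorProduct ENNReal InnerProductSpace

noncomputable section

namespace TensorSampling

/-! ### Riesz sequences and frames -/

section General

variable {H : Type*} [NormedAddCommGroup H] [InnerProductSpace ℂ H]

/-- The closed linear span of a family of vectors. -/
def closedSpan {ι : Type*} (x : ι → H) : Submodule ℂ H :=
  (Submodule.span ℂ (Set.range x)).topologicalClosure

/-- A Riesz sequence: a Riesz basis of its closed span, that is, the image of an orthonormal
basis of the closed span under a bounded operator with bounded inverse. -/
def IsRieszSequence {ι : Type*} (x : ι → H) : Prop :=
  ∃ (e : HilbertBasis ι ℂ (closedSpan x)) (T : closedSpan x ≃L[ℂ] closedSpan x),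
    ∀ i, ((T (e i) : closedSpan x) : H) = x i

/-- The family `x` is a frame for the subspace `K`: its members lie in `K`, and there are frame
bounds `0 < A`, `0 < B` with `A ‖y‖² ≤ ∑ |⟨y, x i⟩|² ≤ B ‖y‖²` for all `y` in `K`. -/
def IsFrameFor {ι : Type*} (K : Submodule ℂ H) (x : ι → H) : Prop :=
  (∀ i, x i ∈ K) ∧
    ∃ A B : ℝ, 0 < A ∧ 0 < B ∧ ∀ y ∈ K,
      Summable (fun i => ‖inner ℂ (x i) y‖ ^ 2) ∧
      A * ‖y‖ ^ 2 ≤ ∑' i, ‖inner ℂ (x i) y‖ ^ 2 ∧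
      ∑' i, ‖inner ℂ (x i) y‖ ^ 2 ≤ B * ‖y‖ ^ 2

theorem IsRieszSequence.summable_sq_inner [CompleteSpace H] {ι : Type*} {x : ι → H}
    (hx : IsRieszSequence x) (h : H) : Summable (fun i => ‖inner ℂ h (x i)‖ ^ 2) := by
  obtain ⟨e, T, hT⟩ := hx
  have : CompleteSpace (closedSpan x) := by unfold closedSpan; infer_instance
  let L : closedSpan x →L[ℂ] H := (closedSpan x).subtypeL ∘L (T : closedSpan x →L[ℂ] closedSpan x)
  have hL : ∀ i, inner ℂ h (x i) = inner ℂ (ContinuousLinearMap.adjoint L h) (e i) := by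
    intro i
    rw [ContinuousLinearMap.adjoint_inner_left, ← hT i]
    rfl
  have := e.orthonormal.inner_products_summable (ContinuousLinearMap.adjoint L h)
  refine this.congr fun i => ?_
  rw [hL i, norm_inner_symm]

end General

/-! ### The Hilbert space tensor product -/

section Tensor

variable (H₁ H₂ : Type*) [NormedAddCommGroup H₁] [InnerProductSpace ℂ H₁]
  [NormedAddCommGroup H₂] [InnerProductSpace ℂ H₂]

/-- The Hilbert space tensor product: the completion of the algebraic tensor product with respect
to the inner product determined by `⟨u ⊗ v, u' ⊗ v'⟩ = ⟨u, u'⟩ ⟨v, v'⟩`. -/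
abbrev HilbertTensor : Type _ := UniformSpace.Completion (H₁ ⊗[ℂ] H₂)

variable {H₁ H₂}

/-- The elementary tensor `u ⊗ v`. -/
def pureTensor (u : H₁) (v : H₂) : HilbertTensor H₁ H₂ :=
  ((u ⊗ₜ[ℂ] v : H₁ ⊗[ℂ] H₂) : HilbertTensor H₁ H₂)

/-- The tensor product `S ⊗ T` of two bounded operators. -/
def tensorOp (S : H₁ →L[ℂ] H₁) (T : H₂ →L[ℂ] H₂) :
    HilbertTensor H₁ H₂ →L[ℂ] HilbertTensor H₁ H₂ :=
  (TensorProduct.mapL S T).completion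

theorem inner_pureTensor (u u' : H₁) (v v' : H₂) :
    inner ℂ (pureTensor u v) (pureTensor u' v') = inner ℂ u u' * inner ℂ v v' := by
  simp [pureTensor]

theorem tensorOp_pureTensor (S : H₁ →L[ℂ] H₁) (T : H₂ →L[ℂ] H₂) (u : H₁) (v : H₂) :
    tensorOp S T (pureTensor u v) = pureTensor (S u) (T v) := by
  simp [tensorOp, pureTensor]

end Tensor

/-! ### The sampling problem

Mathlib's inner product is linear in its second argument, so the inner product `⟨u, v⟩`, linear in
`u`, is written `inner ℂ v u`. -/

section Sampling

variable {H₁ H₂ : Type*} [NormedAddCommGroup H₁] [InnerProductSpace ℂ H₁]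
  [NormedAddCommGroup H₂] [InnerProductSpace ℂ H₂]

/-- The operator `U ^ n ⊗ V ^ m`. -/
def shiftOp (U : H₁ ≃ₗᵢ[ℂ] H₁) (V : H₂ ≃ₗᵢ[ℂ] H₂) (n m : ℤ) :
    HilbertTensor H₁ H₂ →L[ℂ] HilbertTensor H₁ H₂ :=
  tensorOp ((U ^ n : H₁ ≃ₗᵢ[ℂ] H₁) : H₁ →L[ℂ] H₁) ((V ^ m : H₂ ≃ₗᵢ[ℂ] H₂) : H₂ →L[ℂ] H₂)

/-- The closed span of the vectors `U ^ n a ⊗ V ^ p b`, `n ∈ ℤ`, `p = 0, …, N - 1`. -/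
def sampledSpace (U : H₁ ≃ₗᵢ[ℂ] H₁) (V : H₂ ≃ₗᵢ[ℂ] H₂) (a : H₁) (b : H₂) (N : ℕ) :
    Submodule ℂ (HilbertTensor H₁ H₂) :=
  closedSpan fun q : ℤ × Fin N => pureTensor ((U ^ q.1) a) ((V ^ (q.2 : ℕ)) b)

/-- The generalized sample `⟨x, U ^ n h ⊗ V ^ m h'⟩`. -/
def sample (U : H₁ ≃ₗᵢ[ℂ] H₁) (V : H₂ ≃ₗᵢ[ℂ] H₂) (h : H₁) (h' : H₂)
    (x : HilbertTensor H₁ H₂) (n m : ℤ) : ℂ :=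
  inner ℂ (pureTensor ((U ^ n) h) ((V ^ m) h')) x

/-- The Hilbert space `L²(0, 1)`, as the space of square integrable `1`-periodic functions. -/
abbrev L2Circle : Type := Lp ℂ 2 (AddCircle.haarAddCircle : Measure UnitAddCircle)

/-- The function `g(x) = ∑ₖ ⟨a, U ^ k h⟩ exp (2 π i k x)` in `L²(0, 1)`; the series converges
whenever the `U ^ n a` form a Riesz sequence, see `summable_symbol`. -/
def symbol (U : H₁ ≃ₗᵢ[ℂ] H₁) (a h : H₁) : L2Circle :=
  ∑' k : ℤ, (inner ℂ ((U ^ k) h) a : ℂ) • (fourierLp 2 k : L2Circle)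

theorem summable_symbol [CompleteSpace H₁] (U : H₁ ≃ₗᵢ[ℂ] H₁) (a h : H₁)
    (ha : IsRieszSequence fun n : ℤ => (U ^ n) a) :
    Summable fun k : ℤ => (inner ℂ ((U ^ k) h) a : ℂ) • (fourierLp 2 k : L2Circle) := by
  have h1 : ∀ k : ℤ, (inner ℂ ((U ^ k) h) a : ℂ) = inner ℂ h ((U ^ (-k)) a) := by
    intro k
    have h0 : (U ^ k) ((U ^ (-k)) a) = a := by
      change (U ^ k * U ^ (-k)) a = a
      rw [← zpow_add, add_neg_cancel, zpow_zero]
      rfl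
    conv_lhs => rw [← h0]
    exact LinearIsometryEquiv.inner_map_map (U ^ k) _ _
  have h2 : Summable fun k : ℤ => ‖(inner ℂ ((U ^ k) h) a : ℂ)‖ ^ 2 := by
    simp only [h1]
    exact (Equiv.neg ℤ).summable_iff.mpr (ha.summable_sq_inner h)
  have h3 := (orthonormal_fourier (T := (1 : ℝ))).orthogonalFamily.summable_iff_norm_sq_summable
    (fun k : ℤ => (inner ℂ ((U ^ k) h) a : ℂ))
  simpa using h3.mpr h2

/-- The `s × r` matrix `G(x) = (g_j (x + k / r))`, `k = 0, …, r - 1`, of a family of `1`-periodic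
functions. -/
def polyMatrix {s : ℕ} (r : ℕ) (g : Fin s → L2Circle) (x : ℝ) : Matrix (Fin s) (Fin r) ℂ :=
  Matrix.of fun j k => g j ((x + (k : ℝ) / (r : ℝ) : ℝ) : UnitAddCircle)

/-- The smallest eigenvalue of `G* G` (for a matrix `G` with at least one column). -/
def lambdaMin {s r : ℕ} (G : Matrix (Fin s) (Fin r) ℂ) : ℝ :=
  ⨅ i, (Matrix.isHermitian_conjTranspose_mul_self G).eigenvalues i

/-- The largest eigenvalue of `G* G` (for a matrix `G` with at least one column). -/
def lambdaMax {s r : ℕ} (G : Matrix (Fin s) (Fin r) ℂ) : ℝ :=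
  ⨆ i, (Matrix.isHermitian_conjTranspose_mul_self G).eigenvalues i

/-- The essential infimum over `x ∈ (0, 1 / r)` of the smallest eigenvalue of `G(x)* G(x)`. -/
def alphaG {s : ℕ} (r : ℕ) (g : Fin s → L2Circle) : ℝ≥0∞ :=
  essInf (fun x : ℝ => ENNReal.ofReal (lambdaMin (polyMatrix r g x)))
    (volume.restrict (Set.Ioo (0 : ℝ) (1 / (r : ℝ))))

/-- The essential supremum over `x ∈ (0, 1 / r)` of the largest eigenvalue of `G(x)* G(x)`. -/
def betaG {s : ℕ} (r : ℕ) (g : Fin s → L2Circle) : ℝ≥0∞ :=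
  essSup (fun x : ℝ => ENNReal.ofReal (lambdaMax (polyMatrix r g x)))
    (volume.restrict (Set.Ioo (0 : ℝ) (1 / (r : ℝ))))

/-- The cross-covariance `⟨V ^ q b, h⟩`. -/
def crossCov (V : H₂ ≃ₗᵢ[ℂ] H₂) (b h : H₂) (q : ℤ) : ℂ := inner ℂ h ((V ^ q) b)

/-- The `s' ℓ × N` matrix of cross-covariances, `ℓ = N / rbar`. Its row with index `(j', m)`
consists of the numbers `⟨V ^ (N - rbar m + p) b, h j'⟩`, `p = 0, …, N - 1`. -/
def crossCovMatrix (V : H₂ ≃ₗᵢ[ℂ] H₂) (b : H₂) (N rbar : ℕ) {s' : ℕ} (h : Fin s' → H₂) :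
    Matrix (Fin s' × Fin (N / rbar)) (Fin N) ℂ :=
  Matrix.of fun i p =>
    crossCov V b (h i.1) ((N : ℤ) - (rbar : ℤ) * ((i.2 : ℕ) : ℤ) + ((p : ℕ) : ℤ))

end Sampling

end TensorSampling

end

open TensorSampling

/-! Inner products of elementary tensors factor, so the problem splits into one sampling problem in
each factor, the second being finite dimensional.

First factor: the Riesz property identifies the closed span of the `U ^ n a` with `L²` of the circle
(`IsRieszSequence.exists_equiv`). If `F` corresponds to `u`, the samples of `u` are the Fourier
coefficients of `g_j F` at multiples of `r` (`inner_zpow_eq_fourierCoeff`). Averaging over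
translates by `k / r` isolates these frequencies, so Parseval turns the total sample energy into
`r⁻²` times the integral of the squared norm of `G(θ)` applied to the vector `(F(θ + k/r))`
(`hasSum_sampleEnergy`). A lower bound for the samples is therefore a uniform lower bound for `G*
G`; passing from the integral to almost every point is the localization `ae_le_sampleEnergy`. This
gives `alphaG_pos_iff_exists_lower_bound`.

Second factor: the cross-covariance matrix is the sampling map written in the basis `V ^ p b`, so
rank `N` means injectivity, which in finite dimension is again a lower bound
(`rank_crossCovMatrix_eq_iff`, `exists_lower_bound_of_finite`).

(a) to (b): each lower bound yields a canonical dual frame, which is again an orbit because the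
inverse frame operator commutes with the group action (`exists_dualOp`, `exists_dual_orbit`).
Tensoring the two duals reconstructs the tensor space (`hasSum_tensor`, `isFrameFor_tensor`). (b) to
(c) is immediate. (c) to (a): pairing the expansion of `z` with `z` and applying Cauchy-Schwarz
bounds `‖z‖²` by a multiple of the sample energy. For `z = u ⊗ v` this energy is a product, and
freezing `v = b` or `u = a` gives the condition on the other factor
(`mul_norm_sq_le_of_reconstruction`). -/

namespace TensorSampling

/-! ### Bessel families, frame operators and canonical duals -/

section Frames

variable {H : Type*} [NormedAddCommGroup H] [InnerProductSpace ℂ H] {ι : Type*}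

/-- A Bessel family with bound `B`. -/
def IsBessel (f : ι → H) (B : ℝ) : Prop :=
  ∀ y, Summable (fun i => ‖inner ℂ (f i) y‖ ^ 2) ∧ ∑' i, ‖inner ℂ (f i) y‖ ^ 2 ≤ B * ‖y‖ ^ 2

/-- Pair the expansion with `y` itself and apply Cauchy-Schwarz to the finite partial sums. The
bound is symmetric in the two energies, so an upper bound on either one forces a lower bound on the
other. -/
theorem sq_norm_sq_le_tsum_mul_tsum {c : ι → ℂ} {C : ι → H} {y : H}
    (h : HasSum (fun i => c i • C i) y) (hc : Summable fun i => ‖c i‖ ^ 2)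
    (hC : Summable fun i => ‖inner ℂ (C i) y‖ ^ 2) :
    (‖y‖ ^ 2) ^ 2 ≤ (∑' i, ‖c i‖ ^ 2) * ∑' i, ‖inner ℂ (C i) y‖ ^ 2 := by
  have h1 : HasSum (fun i => c i * inner ℂ y (C i)) (inner ℂ y y) := by
    simpa [inner_smul_right] using (innerSL ℂ y).hasSum h
  have h2 : Filter.Tendsto (fun t : Finset ι => ‖∑ i ∈ t, c i * inner ℂ y (C i)‖ ^ 2) Filter.atTop
      (nhds (‖(inner ℂ y y : ℂ)‖ ^ 2)) := (h1.norm).pow 2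
  have h3 : ‖(inner ℂ y y : ℂ)‖ = ‖y‖ ^ 2 := by
    rw [inner_self_eq_norm_sq_to_K]; simp
  rw [h3] at h2
  refine le_of_tendsto' h2 fun t => ?_
  calc ‖∑ i ∈ t, c i * inner ℂ y (C i)‖ ^ 2
      ≤ (∑ i ∈ t, ‖c i‖ * ‖inner ℂ (C i) y‖) ^ 2 := by
        gcongr
        refine (norm_sum_le _ _).trans (le_of_eq ?_)
        exact Finset.sum_congr rfl fun i _ => by rw [norm_mul, norm_inner_symm]
    _ ≤ (∑ i ∈ t, ‖c i‖ ^ 2) * ∑ i ∈ t, ‖inner ℂ (C i) y‖ ^ 2 :=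
        Finset.sum_mul_sq_le_sq_mul_sq _ _ _
    _ ≤ _ := by
        gcongr
        · exact hc.sum_le_tsum _ fun _ _ => by positivity
        · exact hC.sum_le_tsum _ fun _ _ => by positivity

/-- If a Bessel family reconstructs `y` from the coefficients `c`, then `c` is bounded below. -/
theorem norm_sq_le_mul_tsum {c : ι → ℂ} {C : ι → H} {y : H} {B : ℝ} (hB0 : 0 ≤ B)
    (h : HasSum (fun i => c i • C i) y) (hc : Summable fun i => ‖c i‖ ^ 2)
    (hC : Summable fun i => ‖inner ℂ (C i) y‖ ^ 2)
    (hB : ∑' i, ‖inner ℂ (C i) y‖ ^ 2 ≤ B * ‖y‖ ^ 2) :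
    ‖y‖ ^ 2 ≤ B * ∑' i, ‖c i‖ ^ 2 := by
  have h1 := sq_norm_sq_le_tsum_mul_tsum h hc hC
  have h2 : 0 ≤ ∑' i, ‖c i‖ ^ 2 := tsum_nonneg fun _ => by positivity
  have h3 := mul_le_mul_of_nonneg_left hB h2
  rcases eq_or_ne y 0 with rfl | hy
  · simpa using mul_nonneg hB0 h2
  · have hy' : 0 < ‖y‖ ^ 2 := by positivity
    nlinarith

/-- The analysis operator of a Bessel family. -/
theorem IsBessel.exists_analysis {f : ι → H} {B : ℝ} (hf : IsBessel f B) :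
    ∃ Θ : H →L[ℂ] lp (fun _ : ι => ℂ) 2, ∀ y i, Θ y i = inner ℂ (f i) y := by
  have hm : ∀ y, Memℓp (fun i => (inner ℂ (f i) y : ℂ)) 2 := fun y =>
    memℓp_gen (by simpa using (hf y).1)
  let Θ : H →ₗ[ℂ] lp (fun _ : ι => ℂ) 2 :=
    { toFun := fun y => ⟨fun i => inner ℂ (f i) y, hm y⟩
      map_add' := fun x y => by ext i; exact inner_add_right _ _ _
      map_smul' := fun c y => by ext i; exact inner_smul_right _ _ _ }
  refine ⟨Θ.mkContinuous (Real.sqrt B) fun y => ?_, fun y i => rfl⟩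
  have h1 : ‖Θ y‖ ^ 2 = ∑' i, ‖inner ℂ (f i) y‖ ^ 2 := by
    simpa [Θ] using lp.norm_rpow_eq_tsum (p := 2) (by norm_num) (Θ y)
  have h2 := h1.trans_le (hf y).2
  rcases eq_or_ne y 0 with rfl | hy
  · simp
  -- The definition of a Bessel bound does not fix the sign of `B`; a nonzero vector forces it.
  have hB : 0 ≤ B := by
    have hy' : 0 < ‖y‖ ^ 2 := by positivity
    by_contra! hneg
    nlinarith [sq_nonneg ‖Θ y‖]
  rw [← abs_of_nonneg (norm_nonneg (Θ y)), ← Real.sqrt_sq_eq_abs]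
  refine (Real.sqrt_le_sqrt h2).trans (le_of_eq ?_)
  rw [Real.sqrt_mul hB, Real.sqrt_sq (norm_nonneg y)]

/-- The frame operator of a Bessel family. -/
theorem IsBessel.exists_frameOp [CompleteSpace H] {f : ι → H} {B : ℝ} (hf : IsBessel f B) :
    ∃ S : H →L[ℂ] H, S.IsPositive ∧ (∀ y, HasSum (fun i => inner ℂ (f i) y • f i) (S y)) ∧
      ∀ y, inner ℂ (S y) y = ((∑' i, ‖inner ℂ (f i) y‖ ^ 2 : ℝ) : ℂ) := by
  classical
  obtain ⟨Θ, hΘ⟩ := hf.exists_analysis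
  -- The adjoint sends unit vectors to the `f i`, so applying it to the coordinate expansion of `Θ
  -- y` produces the frame series.
  have hs : ∀ i, ContinuousLinearMap.adjoint Θ (lp.single 2 i 1) = f i := by
    intro i
    refine ext_inner_right ℂ fun y => ?_
    rw [ContinuousLinearMap.adjoint_inner_left, lp.inner_single_left, hΘ]
    simp
  refine ⟨ContinuousLinearMap.adjoint Θ ∘L Θ, ContinuousLinearMap.isPositive_adjoint_comp_self Θ,
    fun y => ?_, fun y => ?_⟩
  · have h1 := (ContinuousLinearMap.adjoint Θ).hasSum (lp.hasSum_single (by norm_num) (Θ y))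
    refine h1.congr_fun fun i => ?_
    have h2 : lp.single (E := fun _ : ι => ℂ) 2 i (Θ y i) =
        (Θ y i) • lp.single (E := fun _ : ι => ℂ) 2 i 1 := by
      rw [← lp.single_smul, smul_eq_mul, mul_one]
    rw [h2, map_smul, hs, hΘ]
  · rw [ContinuousLinearMap.comp_apply, ContinuousLinearMap.adjoint_inner_left,
      inner_self_eq_norm_sq_to_K]
    have h1 : ‖Θ y‖ ^ 2 = ∑' i, ‖inner ℂ (f i) y‖ ^ 2 := by
      simpa [hΘ] using lp.norm_rpow_eq_tsum (p := 2) (by norm_num) (Θ y)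
    rw [← h1]; simp

/-- Invariance of `K` under the inverse is what makes the unitary `W` preserve the orthogonal
complement as well. -/
theorem starProjection_commute_of_mapsTo {K : Submodule ℂ H} [K.HasOrthogonalProjection]
    (W : H ≃ₗᵢ[ℂ] H) (h : ∀ x ∈ K, W x ∈ K) (h' : ∀ x ∈ K, W.symm x ∈ K) (y : H) :
    K.starProjection (W y) = W (K.starProjection y) := by
  refine Submodule.eq_starProjection_of_mem_orthogonal (h _ (by simp)) ?_
  rw [← map_sub, Submodule.mem_orthogonal]
  intro u hu
  have h1 := (Submodule.mem_orthogonal K _).1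
    (Submodule.sub_starProjection_mem_orthogonal (K := K) y) _ (h' u hu)
  rwa [← W.inner_map_map, W.apply_symm_apply] at h1

/-- Canonical dual frames: the operator `D` turns a frame `f` of `K` into a dual frame, and it
commutes with all symmetries of the frame. -/
theorem exists_dualOp [CompleteSpace H] {K : Submodule ℂ H} (hKc : IsClosed (K : Set H))
    [K.HasOrthogonalProjection] {f : ι → H} {A B : ℝ}
    (hf : IsBessel f B) (hfK : ∀ i, f i ∈ K) (hA : 0 < A)
    (hlow : ∀ y ∈ K, A * ‖y‖ ^ 2 ≤ ∑' i, ‖inner ℂ (f i) y‖ ^ 2) :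
    ∃ D : H →L[ℂ] H, (∀ y ∈ K, D y ∈ K) ∧
      (∀ y ∈ K, HasSum (fun i => inner ℂ (f i) y • D (f i)) y) ∧
      ∀ W : H ≃ₗᵢ[ℂ] H, (∀ x ∈ K, W x ∈ K) → (∀ x ∈ K, W.symm x ∈ K) →
        (∃ σ : ι ≃ ι, ∀ i, f (σ i) = W (f i)) → ∀ y, D (W y) = W (D y) := by
  obtain ⟨S, hS, hSsum, hSin⟩ := hf.exists_frameOp
  set P := K.starProjection with hP
  have hSK : ∀ y, S y ∈ K := fun y => hKc.mem_of_tendsto (hSsum y)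
    (Filter.Eventually.of_forall fun t => K.sum_mem fun i _ => K.smul_mem _ (hfK i))
  have hfP : ∀ i y, inner ℂ (f i) (P y) = inner ℂ (f i) y := fun i y => by
    rw [hP, ← Submodule.inner_starProjection_left_eq_right,
      Submodule.starProjection_eq_self_iff.2 (hfK i)]
  have hSP : ∀ y, S (P y) = S y := fun y =>
    (hSsum (P y)).unique (by simpa only [hfP] using hSsum y)
  -- The frame operator vanishes on the complement of `K`; adding the projection onto that
  -- complement makes it invertible on all of `H` without changing it on `K`. The lower bound is
  -- then `A` on `K` and `1` on the complement, hence `min A 1`.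
  set R : H →L[ℂ] H := S + (1 - P) with hR
  set m := min A 1 with hm
  have hm0 : 0 < m := lt_min hA one_pos
  have hR1 : algebraMap ℝ (H →L[ℂ] H) m ≤ R := by
    rw [ContinuousLinearMap.le_def, ContinuousLinearMap.isPositive_iff]
    constructor
    · rw [← ContinuousLinearMap.isSelfAdjoint_iff_isSymmetric]
      refine (hS.isSelfAdjoint.add ((IsSelfAdjoint.one _).sub ?_)).sub ?_
      · exact isSelfAdjoint_starProjection K
      · exact (IsSelfAdjoint.all m).algebraMap _
    · intro y
      have h1 : inner ℂ (S y) y = ((∑' i, ‖inner ℂ (f i) (P y)‖ ^ 2 : ℝ) : ℂ) := by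
        rw [hSin]; simp only [hfP]
      have h2 : inner ℂ (y - P y) y = ((‖y - P y‖ ^ 2 : ℝ) : ℂ) := by
        have h3 : inner ℂ (y - P y) (P y) = (0 : ℂ) :=
          K.starProjection_inner_eq_zero _ _ (by simp [hP])
        have h4 : y = (y - P y) + P y := by abel
        conv_lhs => rw [h4]
        rw [inner_add_right]
        simp [h3, inner_self_eq_norm_sq_to_K]
      have h5 : ‖y‖ ^ 2 = ‖P y‖ ^ 2 + ‖y - P y‖ ^ 2 := by
        rw [K.norm_sq_eq_add_norm_sq_starProjection y, Submodule.starProjection_orthogonal_val]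
      have h6 : inner ℂ ((R - algebraMap ℝ (H →L[ℂ] H) m) y) y =
          ((∑' i, ‖inner ℂ (f i) (P y)‖ ^ 2 + ‖y - P y‖ ^ 2 - m * ‖y‖ ^ 2 : ℝ) : ℂ) := by
        have : (R - algebraMap ℝ (H →L[ℂ] H) m) y = S y + (y - P y) - (m : ℂ) • y := by
          simp [hR, Algebra.algebraMap_eq_smul_one]
        rw [this, inner_sub_left, inner_add_left, h1, h2, inner_smul_left]
        simp [inner_self_eq_norm_sq_to_K]
      rw [h6, Complex.zero_le_real]
      have h7 := hlow (P y) (by simp [hP])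
      have h8 : m ≤ A := min_le_left _ _
      have h9 : m ≤ 1 := min_le_right _ _
      nlinarith [sq_nonneg ‖P y‖, sq_nonneg ‖y - P y‖]
  have hRu : IsUnit R := by
    refine CStarAlgebra.isUnit_of_le _ hR1 (isStrictlyPositive_algebraMap hm0)
  set D : H →L[ℂ] H := Ring.inverse R with hD
  have hDR : ∀ y, D (R y) = y := fun y => by
    have := Ring.inverse_mul_cancel R hRu
    exact congrArg (fun T : H →L[ℂ] H => T y) this
  have hcomm : ∀ W : H →L[ℂ] H, Commute R W → ∀ y, D (W y) = W (D y) := fun W hW y => by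
    have : Commute D W := by
      obtain ⟨u, hu⟩ := hRu
      rw [hD, ← hu, Ring.inverse_unit]
      rw [← hu] at hW
      exact hW.units_inv_left
    exact congrArg (fun T : H →L[ℂ] H => T y) this.eq
  have hRK : ∀ y ∈ K, R y = S y := fun y hy => by
    simp [hR, hP, Submodule.starProjection_eq_self_iff.2 hy]
  refine ⟨D, fun y hy => ?_, fun y hy => ?_, fun W hW hW' ⟨σ, hσ⟩ => ?_⟩
  · have h1 : Commute R P := by
      ext z
      have := hSP z
      simp [hR, hP, Submodule.starProjection_eq_self_iff.2 (hSK z)] at this ⊢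
      exact this
    have h2 := hcomm P h1 y
    rw [hP, Submodule.starProjection_eq_self_iff.2 hy] at h2
    rw [h2]; simp
  · have h1 := D.hasSum (hSsum y)
    rw [← hRK y hy, hDR] at h1
    simpa using h1
  · refine hcomm (W : H →L[ℂ] H) ?_
    ext z
    -- Reindexing the frame series by `σ` absorbs `W`, since `W` merely permutes the frame.
    have h1 : S (W z) = W (S z) := by
      have h2 := (Equiv.hasSum_iff σ).2 (hSsum (W z))
      have h3 := (W : H →L[ℂ] H).hasSum (hSsum z)
      refine h2.unique (h3.congr_fun fun i => ?_)
      simp [hσ]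
    simp [hR, h1, hP, starProjection_commute_of_mapsTo W hW hW']

theorem IsBessel.map [CompleteSpace H] {f : ι → H} {B : ℝ} (hB : 0 ≤ B) (hf : IsBessel f B)
    {H' : Type*} [NormedAddCommGroup H'] [InnerProductSpace ℂ H'] [CompleteSpace H']
    (D : H →L[ℂ] H') : IsBessel (fun i => D (f i)) (B * ‖D‖ ^ 2) := by
  intro y
  simp only [← ContinuousLinearMap.adjoint_inner_right]
  refine ⟨(hf _).1, (hf _).2.trans ?_⟩
  rw [mul_assoc, ← mul_pow]
  gcongr
  simpa using (ContinuousLinearMap.adjoint D).le_opNorm y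

/-- The sampling vectors need not lie in `K`. Projecting them leaves their inner products with `K`
unchanged and makes a bound known only on `K` global. -/
theorem IsBessel.starProjection {K : Submodule ℂ H} [K.HasOrthogonalProjection] {f : ι → H}
    {B : ℝ} (hB : 0 ≤ B)
    (hf : ∀ y ∈ K, Summable (fun i => ‖inner ℂ (f i) y‖ ^ 2) ∧
      ∑' i, ‖inner ℂ (f i) y‖ ^ 2 ≤ B * ‖y‖ ^ 2) :
    IsBessel (fun i => K.starProjection (f i)) B := by
  intro y
  simp only [Submodule.inner_starProjection_left_eq_right]
  obtain ⟨h1, h2⟩ := hf (K.starProjection y) (by simp)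
  refine ⟨h1, h2.trans ?_⟩
  gcongr
  exact K.norm_starProjection_apply_le y

/-- Only the lower frame bound needs an argument: it is the reciprocal of the Bessel bound of the
analysing family, by the Cauchy-Schwarz estimate for the expansion. -/
theorem isFrameFor_of_hasSum {K : Submodule ℂ H} {f C : ι → H} {B B' : ℝ} (hB : 0 < B)
    (hB' : 0 < B') (hCK : ∀ i, C i ∈ K) (hC : IsBessel C B)
    (hf : ∀ y ∈ K, Summable (fun i => ‖inner ℂ (f i) y‖ ^ 2) ∧
      ∑' i, ‖inner ℂ (f i) y‖ ^ 2 ≤ B' * ‖y‖ ^ 2)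
    (h : ∀ y ∈ K, HasSum (fun i => inner ℂ (f i) y • C i) y) : IsFrameFor K C := by
  refine ⟨hCK, 1 / B', B, by positivity, hB, fun y hy => ⟨(hC y).1, ?_, (hC y).2⟩⟩
  have h1 := sq_norm_sq_le_tsum_mul_tsum (h y hy) (hf y hy).1 (hC y).1
  have h2 : 0 ≤ ∑' i, ‖inner ℂ (C i) y‖ ^ 2 := tsum_nonneg fun _ => by positivity
  have h3 := mul_le_mul_of_nonneg_right (hf y hy).2 h2
  rw [div_mul_eq_mul_div, one_mul, div_le_iff₀ hB']
  rcases eq_or_ne y 0 with rfl | hy0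
  · simp
  · have hy' : 0 < ‖y‖ ^ 2 := by positivity
    nlinarith

end Frames

theorem hasSum_prod_fintype {κ ι E : Type*} [Fintype κ] [AddCommMonoid E] [TopologicalSpace E]
    [ContinuousAdd E] {F : κ → ι → E} {a : κ → E} (h : ∀ k, HasSum (F k) (a k)) :
    HasSum (fun p : κ × ι => F p.1 p.2) (∑ k, a k) := by
  classical
  have h1 : ∀ k, HasSum (fun p : κ × ι => if p.1 = k then F k p.2 else 0) (a k) := fun k => by
    refine (Function.Injective.hasSum_iff (g := fun i : ι => (k, i))
      (fun i j hij => (Prod.ext_iff.1 hij).2) ?_).1 ?_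
    · rintro ⟨k', i⟩ hp
      rw [if_neg]
      rintro rfl
      exact hp ⟨i, rfl⟩
    · simpa [Function.comp_def] using h k
  simpa using hasSum_sum (s := Finset.univ) fun k _ => h1 k

/-! ### Slicing operators and reconstruction in the tensor product -/

section TensorFrames

variable {H₁ H₂ : Type*} [NormedAddCommGroup H₁] [InnerProductSpace ℂ H₁]
  [NormedAddCommGroup H₂] [InnerProductSpace ℂ H₂]

theorem norm_pureTensor (u : H₁) (v : H₂) : ‖pureTensor u v‖ = ‖u‖ * ‖v‖ := by
  simp [pureTensor]

theorem pureTensor_add (u : H₁) (v v' : H₂) :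
    pureTensor u (v + v') = pureTensor u v + pureTensor u v' := by
  rw [pureTensor, TensorProduct.tmul_add]
  exact UniformSpace.Completion.coe_add _ _

theorem add_pureTensor (u u' : H₁) (v : H₂) :
    pureTensor (u + u') v = pureTensor u v + pureTensor u' v := by
  rw [pureTensor, TensorProduct.add_tmul]
  exact UniformSpace.Completion.coe_add _ _

theorem pureTensor_smul (c : ℂ) (u : H₁) (v : H₂) :
    pureTensor u (c • v) = c • pureTensor u v := by
  rw [pureTensor, TensorProduct.tmul_smul]
  exact UniformSpace.Completion.coe_smul _ _

theorem smul_pureTensor (c : ℂ) (u : H₁) (v : H₂) :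
    pureTensor (c • u) v = c • pureTensor u v := by
  rw [pureTensor, ← TensorProduct.smul_tmul']
  exact UniformSpace.Completion.coe_smul _ _

/-- The operator `u ↦ u ⊗ v`. -/
noncomputable def tensorRight (v : H₂) : H₁ →L[ℂ] HilbertTensor H₁ H₂ :=
  LinearMap.mkContinuous
    { toFun := fun u => pureTensor u v
      map_add' := fun u u' => add_pureTensor u u' v
      map_smul' := fun c u => smul_pureTensor c u v }
    ‖v‖ fun u => ((norm_pureTensor u v).trans (mul_comm _ _)).le

/-- The operator `v ↦ u ⊗ v`. -/
noncomputable def tensorLeft (u : H₁) : H₂ →L[ℂ] HilbertTensor H₁ H₂ :=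
  LinearMap.mkContinuous
    { toFun := fun v => pureTensor u v
      map_add' := pureTensor_add u
      map_smul' := fun c v => pureTensor_smul c u v }
    ‖u‖ fun v => (norm_pureTensor u v).le

@[simp] theorem tensorRight_apply (u : H₁) (v : H₂) : tensorRight v u = pureTensor u v := rfl

@[simp] theorem tensorLeft_apply (u : H₁) (v : H₂) : tensorLeft u v = pureTensor u v := rfl

theorem norm_tensorRight_le (v : H₂) : ‖(tensorRight v : H₁ →L[ℂ] _)‖ ≤ ‖v‖ :=
  LinearMap.mkContinuous_norm_le _ (norm_nonneg v) _

section ClosedSpan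

variable {H : Type*} [NormedAddCommGroup H] [InnerProductSpace ℂ H] {ι : Type*}

theorem isClosed_closedSpan (x : ι → H) : IsClosed (closedSpan x : Set H) :=
  Submodule.isClosed_topologicalClosure _

theorem mem_closedSpan (x : ι → H) (i : ι) : x i ∈ closedSpan x :=
  Submodule.le_topologicalClosure _ (Submodule.subset_span ⟨i, rfl⟩)

theorem closedSpan_le {x : ι → H} {M : Submodule ℂ H} (hM : IsClosed (M : Set H))
    (h : ∀ i, x i ∈ M) : closedSpan x ≤ M :=
  Submodule.topologicalClosure_minimal _ (Submodule.span_le.2 (by rintro _ ⟨i, rfl⟩; exact h i)) hM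

variable {G : Type*} [NormedAddCommGroup G] [InnerProductSpace ℂ G]

theorem map_mem_of_mem_closedSpan {x : ι → H} {M : Submodule ℂ G} (hM : IsClosed (M : Set G))
    (T : H →L[ℂ] G) (h : ∀ i, T (x i) ∈ M) {y : H} (hy : y ∈ closedSpan x) : T y ∈ M :=
  closedSpan_le (M := M.comap (T : H →ₗ[ℂ] G)) (hM.preimage T.continuous) h hy

theorem map_eq_of_mem_closedSpan {x : ι → H} (T T' : H →L[ℂ] G)
    (h : ∀ i, T (x i) = T' (x i)) {y : H} (hy : y ∈ closedSpan x) : T y = T' y := by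
  have := map_mem_of_mem_closedSpan (M := ⊥) (by simp) (T - T') (by simp [h]) hy
  simpa [sub_eq_zero] using this

end ClosedSpan

variable {ι κ α β : Type*} {x : α → H₁} {y : β → H₂}

theorem pureTensor_mem_closedSpan {u : H₁} {v : H₂} (hu : u ∈ closedSpan x)
    (hv : v ∈ closedSpan y) :
    pureTensor u v ∈ closedSpan fun q : α × β => pureTensor (x q.1) (y q.2) := by
  refine map_mem_of_mem_closedSpan (isClosed_closedSpan _) (tensorRight v) (fun i => ?_) hu
  refine map_mem_of_mem_closedSpan (isClosed_closedSpan _) (tensorLeft (x i)) (fun j => ?_) hv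
  exact mem_closedSpan (fun q : α × β => pureTensor (x q.1) (y q.2)) (i, j)

variable [CompleteSpace H₁]

/-- This adjoint is the partial inner product with `h` in the second variable. It slices a tensor
into a vector of the first factor, where one-factor results apply. -/
theorem adjoint_tensorRight_pureTensor (h : H₂) (u : H₁) (v : H₂) :
    ContinuousLinearMap.adjoint (tensorRight h) (pureTensor u v) = inner ℂ h v • u := by
  refine ext_inner_left ℂ fun w => ?_
  rw [ContinuousLinearMap.adjoint_inner_right, tensorRight_apply, inner_pureTensor,
    inner_smul_right, mul_comm]

theorem adjoint_tensorRight_mem (h : H₂) {z : HilbertTensor H₁ H₂}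
    (hz : z ∈ closedSpan fun q : α × β => pureTensor (x q.1) (y q.2)) :
    ContinuousLinearMap.adjoint (tensorRight h) z ∈ closedSpan x := by
  refine map_mem_of_mem_closedSpan (isClosed_closedSpan _) _ (fun q => ?_) hz
  rw [adjoint_tensorRight_pureTensor]
  exact Submodule.smul_mem _ _ (mem_closedSpan _ _)

theorem inner_pureTensor_eq (u : H₁) (v : H₂) (z : HilbertTensor H₁ H₂) :
    inner ℂ (pureTensor u v) z = inner ℂ u (ContinuousLinearMap.adjoint (tensorRight v) z) := by
  rw [ContinuousLinearMap.adjoint_inner_right, tensorRight_apply]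

/-- For fixed `k` the inner series is the first-factor reconstruction of the slice of `z` along `g
k`, tensored with `g' k`. The finite sum over `k` of these operators is continuous and is the
identity on the generators, hence on their closed span. -/
theorem hasSum_tensor [Fintype κ] {f f' : ι → H₁} {g g' : κ → H₂}
    (hf : ∀ u ∈ closedSpan x, HasSum (fun i => inner ℂ (f i) u • f' i) u)
    (hg : ∀ v ∈ closedSpan y, ∑ k, inner ℂ (g k) v • g' k = v) {z : HilbertTensor H₁ H₂}
    (hz : z ∈ closedSpan fun q : α × β => pureTensor (x q.1) (y q.2)) :
    HasSum (fun p : κ × ι => inner ℂ (pureTensor (f p.2) (g p.1)) z •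
      pureTensor (f' p.2) (g' p.1)) z := by
  have h1 : ∀ k, HasSum (fun i => inner ℂ (pureTensor (f i) (g k)) z • pureTensor (f' i) (g' k))
      (tensorRight (g' k) (ContinuousLinearMap.adjoint (tensorRight (g k)) z)) := fun k => by
    have := (tensorRight (g' k)).hasSum (hf _ (adjoint_tensorRight_mem (g k) hz))
    simpa [inner_pureTensor_eq] using this
  have h2 := hasSum_prod_fintype h1
  have h3 : ∑ k, tensorRight (g' k) (ContinuousLinearMap.adjoint (tensorRight (g k)) z) = z := by
    have := map_eq_of_mem_closedSpan
      (∑ k, tensorRight (g' k) ∘L ContinuousLinearMap.adjoint (tensorRight (H₁ := H₁) (g k)))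
      (ContinuousLinearMap.id ℂ _) (fun q => ?_) hz
    · simpa using this
    · have h4 := congrArg (tensorLeft (x q.1)) (hg _ (mem_closedSpan y q.2))
      simpa [adjoint_tensorRight_pureTensor] using h4
  rwa [h3] at h2

/-- Apply the first-factor bound to each slice, whose norm is at most `‖g k‖ ‖z‖`. The membership
condition concerns slices only, so the lemma serves both for the whole space (`K = ⊤`) and for the
closed span. -/
theorem bessel_tensor [Fintype κ] {f : ι → H₁} (g : κ → H₂) {B : ℝ} (hB : 0 ≤ B)
    {K : Submodule ℂ H₁} (hf : ∀ u ∈ K, Summable (fun i => ‖inner ℂ (f i) u‖ ^ 2) ∧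
      ∑' i, ‖inner ℂ (f i) u‖ ^ 2 ≤ B * ‖u‖ ^ 2) {z : HilbertTensor H₁ H₂}
    (hz : ∀ k, ContinuousLinearMap.adjoint (tensorRight (g k)) z ∈ K) :
    Summable (fun p : κ × ι => ‖inner ℂ (pureTensor (f p.2) (g p.1)) z‖ ^ 2) ∧
      ∑' p : κ × ι, ‖inner ℂ (pureTensor (f p.2) (g p.1)) z‖ ^ 2 ≤
        (B * ∑ k, ‖g k‖ ^ 2) * ‖z‖ ^ 2 := by
  simp only [inner_pureTensor_eq]
  have h1 := hasSum_prod_fintype fun k => (hf _ (hz k)).1.hasSum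
  refine ⟨h1.summable, h1.tsum_eq.trans_le ?_⟩
  rw [Finset.mul_sum, Finset.sum_mul]
  refine Finset.sum_le_sum fun k _ => (hf _ (hz k)).2.trans ?_
  rw [mul_assoc, ← mul_pow]
  gcongr
  refine (ContinuousLinearMap.le_opNorm _ _).trans ?_
  gcongr
  rw [LinearIsometryEquiv.norm_map]
  exact norm_tensorRight_le _

end TensorFrames

/-! ### Extreme eigenvalues of `G* G` as optimal quadratic bounds -/

section Eigenvalues

variable {s r : ℕ} (G : Matrix (Fin s) (Fin r) ℂ)

/-- Expand `v` in the orthonormal eigenbasis of `G* G`: the quadratic form becomes diagonal. -/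
theorem sum_norm_sq_mulVec_eq (v : Fin r → ℂ) :
    ∑ j, ‖(G.mulVec v) j‖ ^ 2 =
      ∑ i, (Matrix.isHermitian_conjTranspose_mul_self G).eigenvalues i *
        ‖inner ℂ ((Matrix.isHermitian_conjTranspose_mul_self G).eigenvectorBasis i)
          (WithLp.toLp 2 v)‖ ^ 2 := by
  set hA := Matrix.isHermitian_conjTranspose_mul_self G
  set A := G.conjTranspose * G
  set w : EuclideanSpace ℂ (Fin r) := WithLp.toLp 2 v
  have h1 : ∀ u : EuclideanSpace ℂ (Fin r),
      inner ℂ u (WithLp.toLp 2 (A.mulVec v)) = inner ℂ (WithLp.toLp 2 (G.mulVec u.ofLp))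
        (WithLp.toLp 2 (G.mulVec v) : EuclideanSpace ℂ (Fin s)) := fun u => by
    rw [EuclideanSpace.inner_eq_star_dotProduct, EuclideanSpace.inner_eq_star_dotProduct,
      Matrix.star_mulVec, dotProduct_comm, dotProduct_comm (G.mulVec v), ← Matrix.dotProduct_mulVec,
      Matrix.mulVec_mulVec]
  have h2 : ∀ i, inner ℂ (hA.eigenvectorBasis i) (WithLp.toLp 2 (A.mulVec v)) =
      hA.eigenvalues i * inner ℂ (hA.eigenvectorBasis i) w := fun i => by
    have h3 := h1 (hA.eigenvectorBasis i)
    have h4 := h1 w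
    have h5 : inner ℂ (hA.eigenvectorBasis i) (WithLp.toLp 2 (A.mulVec v)) =
        inner ℂ (WithLp.toLp 2 (A.mulVec (hA.eigenvectorBasis i).ofLp)) w := by
      rw [EuclideanSpace.inner_eq_star_dotProduct, EuclideanSpace.inner_eq_star_dotProduct,
        Matrix.star_mulVec, hA.eq, dotProduct_comm, Matrix.dotProduct_mulVec, dotProduct_comm]
    rw [h5, hA.mulVec_eigenvectorBasis, WithLp.toLp_smul]
    simp [w]
  have h6 := h1 w
  rw [← hA.eigenvectorBasis.sum_inner_mul_inner] at h6
  have h7 : inner ℂ (WithLp.toLp 2 (G.mulVec w.ofLp))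
      (WithLp.toLp 2 (G.mulVec v) : EuclideanSpace ℂ (Fin s)) =
      ((∑ j, ‖(G.mulVec v) j‖ ^ 2 : ℝ) : ℂ) := by
    rw [inner_self_eq_norm_sq_to_K, ← Complex.coe_algebraMap]
    norm_cast
    rw [EuclideanSpace.norm_sq_eq]
  rw [h7] at h6
  have h8 : ∀ i, inner ℂ w (hA.eigenvectorBasis i) *
      inner ℂ (hA.eigenvectorBasis i) (WithLp.toLp 2 (A.mulVec v)) =
      ((hA.eigenvalues i * ‖inner ℂ (hA.eigenvectorBasis i) w‖ ^ 2 : ℝ) : ℂ) := fun i => by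
    rw [h2, mul_left_comm, ← inner_conj_symm w, Complex.conj_mul']
    push_cast
    rfl
  simp only [h8] at h6
  exact_mod_cast h6.symm

theorem sum_norm_sq_inner_eigenvectorBasis (v : Fin r → ℂ) :
    ∑ i, ‖inner ℂ ((Matrix.isHermitian_conjTranspose_mul_self G).eigenvectorBasis i)
          (WithLp.toLp 2 v)‖ ^ 2 = ∑ k, ‖v k‖ ^ 2 := by
  rw [OrthonormalBasis.sum_sq_norm_inner_right, EuclideanSpace.norm_sq_eq]

theorem exists_eigenvalue_eq (i : Fin r) : ∃ v : Fin r → ℂ, ∑ k, ‖v k‖ ^ 2 = 1 ∧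
    ∑ j, ‖(G.mulVec v) j‖ ^ 2 =
      (Matrix.isHermitian_conjTranspose_mul_self G).eigenvalues i := by
  set hA := Matrix.isHermitian_conjTranspose_mul_self G
  refine ⟨(hA.eigenvectorBasis i).ofLp, ?_, ?_⟩
  · rw [← EuclideanSpace.norm_sq_eq, hA.eigenvectorBasis.orthonormal.1 i, one_pow]
  · rw [sum_norm_sq_mulVec_eq, Finset.sum_eq_single i]
    · simp
    · intro k _ hk
      simp [hA.eigenvectorBasis.orthonormal.2 hk]
    · simp

theorem le_lambdaMin_iff (hr : 0 < r) {c : ℝ} : c ≤ lambdaMin G ↔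
    ∀ v : Fin r → ℂ, c * ∑ k, ‖v k‖ ^ 2 ≤ ∑ j, ‖(G.mulVec v) j‖ ^ 2 := by
  have : Nonempty (Fin r) := ⟨⟨0, hr⟩⟩
  rw [lambdaMin, le_ciInf_iff (Set.finite_range _).bddBelow]
  refine ⟨fun h v => ?_, fun h i => ?_⟩
  · rw [sum_norm_sq_mulVec_eq, ← sum_norm_sq_inner_eigenvectorBasis G, Finset.mul_sum]
    gcongr with i
    exact h i
  · obtain ⟨v, h1, h2⟩ := exists_eigenvalue_eq G i
    simpa [h1, h2] using h v

theorem lambdaMax_le_iff (hr : 0 < r) {c : ℝ} : lambdaMax G ≤ c ↔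
    ∀ v : Fin r → ℂ, ∑ j, ‖(G.mulVec v) j‖ ^ 2 ≤ c * ∑ k, ‖v k‖ ^ 2 := by
  have : Nonempty (Fin r) := ⟨⟨0, hr⟩⟩
  rw [lambdaMax, ciSup_le_iff (Set.finite_range _).bddAbove]
  refine ⟨fun h v => ?_, fun h i => ?_⟩
  · rw [sum_norm_sq_mulVec_eq, ← sum_norm_sq_inner_eigenvectorBasis G, Finset.mul_sum]
    gcongr with i
    exact h i
  · obtain ⟨v, h1, h2⟩ := exists_eigenvalue_eq G i
    simpa [h1, h2] using h v

theorem norm_sq_entry_le_lambdaMax (hr : 0 < r) (j : Fin s) (k : Fin r) :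
    ‖G j k‖ ^ 2 ≤ lambdaMax G := by
  have h := (lambdaMax_le_iff G hr).1 le_rfl (Pi.single k 1)
  have h1 : ∑ i, ‖(Pi.single k 1 : Fin r → ℂ) i‖ ^ 2 = 1 := by
    rw [Finset.sum_eq_single k] <;> simp +contextual
  rw [h1, mul_one] at h
  refine le_trans ?_ h
  have := Finset.single_le_sum (f := fun j => ‖(G.mulVec (Pi.single k 1)) j‖ ^ 2)
    (fun _ _ => by positivity) (Finset.mem_univ j)
  simpa using this

theorem lambdaMax_le_of_norm_entry_le (hr : 0 < r) {M : ℝ} (h : ∀ j k, ‖G j k‖ ≤ M) :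
    lambdaMax G ≤ s * r * M ^ 2 := by
  rw [lambdaMax_le_iff G hr]
  intro v
  have hM : ∀ j : Fin s, ‖(G.mulVec v) j‖ ^ 2 ≤ r * M ^ 2 * ∑ k, ‖v k‖ ^ 2 := fun j => by
    calc ‖(G.mulVec v) j‖ ^ 2 ≤ (∑ k, ‖G j k‖ * ‖v k‖) ^ 2 := by
          gcongr
          rw [Matrix.mulVec, dotProduct]
          refine (norm_sum_le _ _).trans (le_of_eq ?_)
          simp
      _ ≤ (∑ k, ‖G j k‖ ^ 2) * ∑ k, ‖v k‖ ^ 2 := Finset.sum_mul_sq_le_sq_mul_sq _ _ _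
      _ ≤ (∑ k : Fin r, M ^ 2) * ∑ k, ‖v k‖ ^ 2 := by
          gcongr with k
          exact h j k
      _ = _ := by simp
  refine (Finset.sum_le_sum fun j _ => hM j).trans (le_of_eq ?_)
  simp; ring

end Eigenvalues

/-! ### Transfer between `(0, 1/r)` and the circle; translation by `k / r` -/

section Circle

open AddCircle (haarAddCircle)

theorem measurePreserving_coe_unitAddCircle :
    MeasurePreserving ((↑) : ℝ → UnitAddCircle) (volume.restrict (Set.Ioc 0 1)) haarAddCircle := by
  have h := AddCircle.measurePreserving_mk 1 0
  simpa [AddCircle.volume_eq_smul_haarAddCircle] using h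

theorem exists_measurePreserving_section :
    ∃ e : UnitAddCircle → ℝ, MeasurePreserving e haarAddCircle
      (volume.restrict (Set.Ioc 0 (0 + 1))) ∧ ∀ θ, (e θ : UnitAddCircle) = θ := by
  have h := (measurePreserving_subtype_coe (μa := volume) measurableSet_Ioc).comp
    (AddCircle.measurePreserving_equivIoc 1 (a := 0))
  rw [AddCircle.volume_eq_smul_haarAddCircle, ENNReal.ofReal_one, one_smul] at h
  exact ⟨_, h, fun θ => AddCircle.coe_equivIoc⟩

theorem ae_coe_add {p : UnitAddCircle → Prop} (h : ∀ᵐ θ ∂haarAddCircle, p θ) {r : ℕ} (hr : 0 < r)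
    (t : ℝ) : ∀ᵐ x ∂volume.restrict (Set.Ioo (0 : ℝ) (1 / (r : ℝ))),
      p ((x + t : ℝ) : UnitAddCircle) := by
  have h1 := (measurePreserving_add_right haarAddCircle
    (t : UnitAddCircle)).quasiMeasurePreserving.ae h
  have h2 := measurePreserving_coe_unitAddCircle.quasiMeasurePreserving.ae h1
  have h3 : Set.Ioo (0 : ℝ) (1 / (r : ℝ)) ⊆ Set.Ioc 0 1 := fun x hx =>
    ⟨hx.1, hx.2.le.trans ((div_le_one (by positivity)).2 (by exact_mod_cast hr))⟩
  filter_upwards [ae_restrict_of_ae_restrict_of_subset h3 h2] with x hx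
  simpa using hx

theorem exists_sub_div_mem_Ioo {r : ℕ} (hr : 0 < r) {x : ℝ} (hx : x ∈ Set.Ioc (0 : ℝ) (0 + 1))
    (hx2 : x ∉ Set.range fun m : ℤ => (m : ℝ) / (r : ℝ)) :
    ∃ k : Fin r, x - (k : ℝ) / (r : ℝ) ∈ Set.Ioo (0 : ℝ) (1 / (r : ℝ)) := by
  have hr' : (0 : ℝ) < r := by exact_mod_cast hr
  have hfl : (⌊x * r⌋ : ℝ) ≠ x * r := fun h => hx2 ⟨⌊x * r⌋, by simp only [h]; field_simp⟩
  have hlt : (⌊x * r⌋ : ℝ) < x * r := lt_of_le_of_ne (Int.floor_le _) hfl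
  have hx1' : x < 1 := by
    refine lt_of_le_of_ne (by simpa using hx.2) fun h => hx2 ⟨(r : ℤ), ?_⟩
    simp [h, hr'.ne']
  have h0 : 0 ≤ ⌊x * r⌋ := Int.floor_nonneg.2 (mul_nonneg hx.1.le hr'.le)
  have hn : ⌊x * r⌋.toNat < r := by
    have : ⌊x * r⌋ < (r : ℤ) := Int.floor_lt.2 (by push_cast; nlinarith)
    omega
  have hc : ((⌊x * r⌋.toNat : ℕ) : ℝ) = (⌊x * r⌋ : ℝ) := by
    exact_mod_cast Int.toNat_of_nonneg h0
  have h5 := Int.lt_floor_add_one (x * r)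
  refine ⟨⟨⌊x * r⌋.toNat, hn⟩, ?_⟩
  simp only [hc, Set.mem_Ioo, sub_pos]
  constructor
  · rwa [div_lt_iff₀ hr']
  · rw [sub_lt_iff_lt_add, ← add_div, lt_div_iff₀ hr']; linarith

/-- The `r` translates of `(0, 1/r)` cover a period up to the grid points `m / r`, which are
countable and hence null. A measure-preserving section carries the statement back to the circle. -/
theorem ae_of_ae_coe_add {p : UnitAddCircle → Prop} {r : ℕ} (hr : 0 < r)
    (h : ∀ k : Fin r, ∀ᵐ x ∂volume.restrict (Set.Ioo (0 : ℝ) (1 / (r : ℝ))),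
      p ((x + (k : ℝ) / (r : ℝ) : ℝ) : UnitAddCircle)) : ∀ᵐ θ ∂haarAddCircle, p θ := by
  have h1 : ∀ᵐ x : ℝ, ∀ k : Fin r, x - (k : ℝ) / r ∈ Set.Ioo (0 : ℝ) (1 / (r : ℝ)) →
      p (x : UnitAddCircle) := by
    rw [ae_all_iff]
    intro k
    have h2 := (ae_restrict_iff' measurableSet_Ioo).1 (h k)
    have h3 : ∀ᵐ x : ℝ, x - (k : ℝ) / r ∈ Set.Ioo (0 : ℝ) (1 / (r : ℝ)) →
        p ((x - (k : ℝ) / r + (k : ℝ) / (r : ℝ) : ℝ) : UnitAddCircle) :=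
      (measurePreserving_sub_right volume ((k : ℝ) / r)).quasiMeasurePreserving.ae h2
    filter_upwards [h3] with x hx hx'
    rw [← sub_add_cancel x ((k : ℝ) / r)]
    exact hx hx'
  have h2 : ∀ᵐ x : ℝ, x ∉ Set.range fun m : ℤ => (m : ℝ) / (r : ℝ) :=
    (Set.countable_range _).ae_notMem _
  have h3 : ∀ᵐ (x : ℝ) ∂volume.restrict (Set.Ioc (0 : ℝ) (0 + 1)), p (x : UnitAddCircle) := by
    rw [ae_restrict_iff' measurableSet_Ioc]
    filter_upwards [h1, h2] with x hx1 hx2 hx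
    obtain ⟨k, hk⟩ := exists_sub_div_mem_Ioo hr hx hx2
    exact hx1 k hk
  obtain ⟨e, he, hcoe⟩ := exists_measurePreserving_section
  filter_upwards [he.quasiMeasurePreserving.tendsto_ae.eventually h3] with θ hθ
  rwa [hcoe] at hθ

/-- The point `k / r` of the circle. -/
noncomputable def circlePt (r k : ℕ) : UnitAddCircle := (((k : ℝ) / (r : ℝ) : ℝ) : UnitAddCircle)

theorem circlePt_add (r k m : ℕ) : circlePt r (k + m) = circlePt r k + circlePt r m := by
  simp only [circlePt, Nat.cast_add, add_div, AddCircle.coe_add]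

theorem circlePt_self_mul {r : ℕ} (hr : 0 < r) (q : ℕ) : circlePt r (r * q) = 0 := by
  have hr' : (r : ℝ) ≠ 0 := by positivity
  rw [circlePt, AddCircle.coe_eq_zero_iff]
  exact ⟨q, by push_cast; field_simp; simp⟩

theorem circlePt_mod {r : ℕ} (hr : 0 < r) (k : ℕ) : circlePt r (k % r) = circlePt r k := by
  conv_rhs => rw [← Nat.mod_add_div k r, circlePt_add, circlePt_self_mul hr, add_zero]

variable {s : ℕ} (r : ℕ)

/-- The matrix `(g_j (θ + k / r))`. -/
noncomputable def circleMatrix (g : Fin s → UnitAddCircle → ℂ) (θ : UnitAddCircle) :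
    Matrix (Fin s) (Fin r) ℂ :=
  Matrix.of fun j k => g j (θ + circlePt r k)

/-- The vector `(F (θ + k / r))`. -/
noncomputable def circleVec (F : UnitAddCircle → ℂ) (θ : UnitAddCircle) (k : Fin r) : ℂ := F (θ + circlePt r k)

theorem polyMatrix_eq (g : Fin s → L2Circle) (x : ℝ) :
    polyMatrix r g x = circleMatrix r (fun j => g j) (x : UnitAddCircle) := by
  ext j k
  simp [polyMatrix, circleMatrix, circlePt]

variable {r}

theorem circlePt_fin_add [NeZero r] (k m : Fin r) :
    circlePt r ((k + m : Fin r) : ℕ) = circlePt r k + circlePt r m := by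
  rw [Fin.val_add, circlePt_mod (Nat.pos_of_neZero r), circlePt_add]

/-- Translation by `m / r` permutes the columns cyclically, the index addition in `Fin r` matching
periodicity on the circle. -/
theorem circleMatrix_add_mulVec [NeZero r] (g : Fin s → UnitAddCircle → ℂ) (θ : UnitAddCircle)
    (m : Fin r) (v : Fin r → ℂ) :
    (circleMatrix r g (θ + circlePt r m)).mulVec (fun k => v (k + m)) =
      (circleMatrix r g θ).mulVec v := by
  ext j
  simp only [Matrix.mulVec, dotProduct, circleMatrix, Matrix.of_apply]
  refine Fintype.sum_equiv (Equiv.addRight m) _ _ fun k => ?_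
  rw [Equiv.coe_addRight, circlePt_fin_add, add_assoc, add_comm (circlePt r m)]

theorem circleVec_add [NeZero r] (F : UnitAddCircle → ℂ) (θ : UnitAddCircle) (m : Fin r) :
    circleVec r F (θ + circlePt r m) = fun k => circleVec r F θ (k + m) := by
  ext k
  simp only [circleVec]
  rw [circlePt_fin_add, add_assoc, add_comm (circlePt r m)]

end Circle

/-! ### Parseval for Fourier coefficients at multiples of `r` -/

section Fourier

open AddCircle (haarAddCircle)

theorem fourierCoeff_comp_add (F : UnitAddCircle → ℂ) (c : UnitAddCircle) (m : ℤ) :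
    fourierCoeff (fun θ => F (θ + c)) m = fourier m c * fourierCoeff F m := by
  have h1 : ∀ t : UnitAddCircle, (fourier (-m) t : ℂ) • F (t + c) =
      fourier m c * ((fourier (-m) (t + c) : ℂ) • F (t + c)) := fun t => by
    have h2 : (fourier (-m) (t + c) : ℂ) = fourier (-m) t * fourier (-m) c := by
      simp [fourier_apply, AddCircle.toCircle_add]
    have h3 : (fourier m c : ℂ) * fourier (-m) c = 1 := by
      rw [← fourier_add]; simp
    rw [h2, smul_eq_mul, smul_eq_mul]
    linear_combination (-(fourier (-m) t : ℂ) * F (t + c)) * h3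
  simp only [fourierCoeff, h1]
  rw [integral_const_mul]
  congr 1
  exact integral_add_right_eq_self (μ := haarAddCircle) (fun t => (fourier (-m) t : ℂ) • F t) c

variable {r : ℕ}

theorem fourier_circlePt (m : ℤ) (k : ℕ) :
    (fourier m (circlePt r k) : ℂ) = (fourier m (circlePt r 1) : ℂ) ^ k := by
  induction k with
  | zero => simp [circlePt]
  | succ k ih =>
    rw [circlePt_add, pow_succ, ← ih]
    simp [fourier_apply, AddCircle.toCircle_add]

theorem fourier_circlePt_one_eq_one_iff (hr : 0 < r) (m : ℤ) :
    (fourier m (circlePt r 1) : ℂ) = 1 ↔ (r : ℤ) ∣ m := by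
  have hr' : (r : ℂ) ≠ 0 := by exact_mod_cast hr.ne'
  rw [circlePt, fourier_coe_apply, Complex.exp_eq_one_iff]
  have hpi : (2 * (Real.pi : ℂ) * Complex.I) ≠ 0 := Complex.two_pi_I_ne_zero
  constructor
  · rintro ⟨n, hn⟩
    refine ⟨n, ?_⟩
    have h1 : (2 * (Real.pi : ℂ) * Complex.I) * (m / r) = (2 * (Real.pi : ℂ) * Complex.I) * n := by
      rw [mul_comm _ (n : ℂ), ← hn]; push_cast; ring
    have h2 := mul_left_cancel₀ hpi h1
    rw [div_eq_iff hr'] at h2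
    rw [mul_comm]
    exact_mod_cast h2
  · rintro ⟨n, rfl⟩
    exact ⟨n, by push_cast; field_simp⟩

/-- The average of `φ` over the translates by `k / r`. -/
noncomputable def circleAverage (r : ℕ) (φ : UnitAddCircle → ℂ) (θ : UnitAddCircle) : ℂ :=
  (r : ℂ)⁻¹ * ∑ k : Fin r, φ (θ + circlePt r k)

theorem sum_fourier_circlePt (hr : 0 < r) (m : ℤ) :
    ∑ k : Fin r, (fourier m (circlePt r k) : ℂ) = if (r : ℤ) ∣ m then (r : ℂ) else 0 := by
  rw [Finset.sum_congr rfl fun (k : Fin r) _ => fourier_circlePt (r := r) m k]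
  rw [Fin.sum_univ_eq_sum_range (fun k => (fourier m (circlePt r 1) : ℂ) ^ k)]
  split_ifs with h
  · rw [(fourier_circlePt_one_eq_one_iff hr m).2 h]; simp
  · have h1 := mt (fourier_circlePt_one_eq_one_iff hr m).1 h
    rw [geom_sum_eq h1, ← fourier_circlePt]
    have h2 : circlePt r r = 0 := by simpa using circlePt_self_mul hr 1
    simp [h2]

/-- A translation multiplies the coefficient by a character; summing that character over the `r`-th
roots of unity leaves only the frequencies divisible by `r`. -/
theorem fourierCoeff_circleAverage (hr : 0 < r) {φ : UnitAddCircle → ℂ}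
    (hφ : Integrable φ haarAddCircle) (m : ℤ) :
    fourierCoeff (circleAverage r φ) m = if (r : ℤ) ∣ m then fourierCoeff φ m else 0 := by
  have h1 : fourierCoeff (circleAverage r φ) m =
      (r : ℂ)⁻¹ * ∑ k : Fin r, fourierCoeff (fun θ => φ (θ + circlePt r k)) m := by
    unfold circleAverage
    rw [fourierCoeff.const_mul]
    congr 1
    have h2 := fourierCoeff.sum (s := Finset.univ) (f := fun (k : Fin r) θ => φ (θ + circlePt r k))
      (fun k _ => hφ.comp_add_right _)
    have h3 := congrFun h2 m
    rw [Finset.sum_apply] at h3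
    rw [← h3]
    refine congrFun (congrArg fourierCoeff ?_) m
    ext θ
    rw [Finset.sum_apply]
  have hr' : (r : ℂ) ≠ 0 := by exact_mod_cast hr.ne'
  rw [h1]
  simp_rw [fourierCoeff_comp_add]
  rw [← Finset.sum_mul, sum_fourier_circlePt hr]
  split_ifs
  · field_simp
  · simp

theorem MemLp.comp_add_circle {φ : UnitAddCircle → ℂ} {p : ℝ≥0∞} (hφ : MemLp φ p haarAddCircle)
    (c : UnitAddCircle) : MemLp (fun θ => φ (θ + c)) p haarAddCircle :=
  hφ.comp_measurePreserving (measurePreserving_add_right _ c)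

theorem memLp_circleAverage {φ : UnitAddCircle → ℂ} {p : ℝ≥0∞} (hφ : MemLp φ p haarAddCircle) :
    MemLp (circleAverage r φ) p haarAddCircle :=
  (memLp_finsetSum Finset.univ fun (k : Fin r) _ =>
    MemLp.comp_add_circle hφ (circlePt r k)).const_mul _

theorem hasSum_sq_fourierCoeff_of_memLp {φ : UnitAddCircle → ℂ} (hφ : MemLp φ 2 haarAddCircle) :
    HasSum (fun n : ℤ => ‖fourierCoeff φ n‖ ^ 2) (∫ θ, ‖φ θ‖ ^ 2 ∂haarAddCircle) := by
  have h1 := hasSum_sq_fourierCoeff (hφ.toLp φ)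
  have h2 : ∫ θ, ‖hφ.toLp φ θ‖ ^ 2 ∂haarAddCircle = ∫ θ, ‖φ θ‖ ^ 2 ∂haarAddCircle := by
    refine integral_congr_ae ?_
    filter_upwards [hφ.coeFn_toLp] with θ hθ
    rw [hθ]
  rw [h2] at h1
  refine h1.congr_fun fun n => ?_
  rw [fourierCoeff_congr_ae hφ.coeFn_toLp]

theorem hasSum_sq_fourierCoeff_mul (hr : 0 < r) {φ : UnitAddCircle → ℂ}
    (hφ : MemLp φ 2 haarAddCircle) :
    HasSum (fun n : ℤ => ‖fourierCoeff φ (r * n)‖ ^ 2)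
      (∫ θ, ‖circleAverage r φ θ‖ ^ 2 ∂haarAddCircle) := by
  have h1 := hasSum_sq_fourierCoeff_of_memLp (memLp_circleAverage (r := r) hφ)
  have hφ' : Integrable φ haarAddCircle := hφ.integrable (by norm_num)
  have hi : Function.Injective fun n : ℤ => (r : ℤ) * n :=
    mul_right_injective₀ (by exact_mod_cast hr.ne')
  have h2 : ∀ m ∉ Set.range fun n : ℤ => (r : ℤ) * n,
      ‖fourierCoeff (circleAverage r φ) m‖ ^ 2 = 0 := by
    intro m hm
    rw [fourierCoeff_circleAverage hr hφ', if_neg]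
    · simp
    · rintro ⟨n, rfl⟩; exact hm ⟨n, rfl⟩
  rw [← hi.hasSum_iff h2] at h1
  refine h1.congr_fun fun n => ?_
  rw [Function.comp_apply, fourierCoeff_circleAverage hr hφ', if_pos (dvd_mul_right _ _)]

variable {s : ℕ} {g : Fin s → UnitAddCircle → ℂ} {F : UnitAddCircle → ℂ}

/-- The energy density of the samples of `F`. -/
noncomputable def sampleEnergy (r : ℕ) (g : Fin s → UnitAddCircle → ℂ) (F : UnitAddCircle → ℂ)
    (θ : UnitAddCircle) : ℝ :=
  ∑ j, ‖((circleMatrix r g θ).mulVec (circleVec r F θ)) j‖ ^ 2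

theorem circleAverage_mul (j : Fin s) (θ : UnitAddCircle) :
    ‖circleAverage r (fun θ => g j θ * F θ) θ‖ ^ 2 =
      ((r : ℝ) ^ 2)⁻¹ * ‖((circleMatrix r g θ).mulVec (circleVec r F θ)) j‖ ^ 2 := by
  rw [circleAverage, norm_mul, mul_pow, norm_inv, Complex.norm_natCast, inv_pow]
  rfl

theorem MemLp.symbol_mul (hg : ∀ j, MemLp (g j) ⊤ haarAddCircle) (hF : MemLp F 2 haarAddCircle)
    (j : Fin s) : MemLp (fun θ => g j θ * F θ) 2 haarAddCircle :=
  hF.mul (hg j)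

theorem integrable_norm_sq_mulVec (hr : 0 < r) (hg : ∀ j, MemLp (g j) ⊤ haarAddCircle)
    (hF : MemLp F 2 haarAddCircle) (j : Fin s) :
    Integrable (fun θ => ‖((circleMatrix r g θ).mulVec (circleVec r F θ)) j‖ ^ 2)
      haarAddCircle := by
  have h1 := (memLp_circleAverage (r := r) (MemLp.symbol_mul hg hF j)).norm.integrable_sq
  simp only [circleAverage_mul] at h1
  have hr' : (r : ℝ) ≠ 0 := by exact_mod_cast hr.ne'
  have h2 := h1.const_mul ((r : ℝ) ^ 2)
  refine h2.congr (Filter.Eventually.of_forall fun θ => ?_)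
  simp only
  field_simp

theorem integrable_sampleEnergy (hr : 0 < r) (hg : ∀ j, MemLp (g j) ⊤ haarAddCircle)
    (hF : MemLp F 2 haarAddCircle) : Integrable (sampleEnergy r g F) haarAddCircle :=
  integrable_finsetSum _ fun j _ => integrable_norm_sq_mulVec hr hg hF j

/-- Parseval for the averages of `g j * F`: each average is `1 / r` times a row of the matrix
applied to the vector of translates of `F`, whence the factor `r⁻²`. -/
theorem hasSum_sampleEnergy (hr : 0 < r) (hg : ∀ j, MemLp (g j) ⊤ haarAddCircle)
    (hF : MemLp F 2 haarAddCircle) :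
    HasSum (fun p : Fin s × ℤ => ‖fourierCoeff (fun θ => g p.1 θ * F θ) (r * p.2)‖ ^ 2)
      (((r : ℝ) ^ 2)⁻¹ * ∫ θ, sampleEnergy r g F θ ∂haarAddCircle) := by
  have h1 := hasSum_prod_fintype fun j : Fin s =>
    hasSum_sq_fourierCoeff_mul hr (MemLp.symbol_mul hg hF j)
  have h2 : ∑ j, ∫ θ, ‖circleAverage r (fun θ => g j θ * F θ) θ‖ ^ 2 ∂haarAddCircle =
      ((r : ℝ) ^ 2)⁻¹ * ∫ θ, sampleEnergy r g F θ ∂haarAddCircle := by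
    unfold sampleEnergy
    rw [integral_finsetSum _ fun j _ => integrable_norm_sq_mulVec hr hg hF j, Finset.mul_sum]
    simp only [circleAverage_mul, integral_const_mul]
  rwa [h2] at h1

theorem integrable_norm_sq_circleVec (hF : MemLp F 2 haarAddCircle) (k : Fin r) :
    Integrable (fun θ => ‖circleVec r F θ k‖ ^ 2) haarAddCircle :=
  (MemLp.comp_add_circle hF (circlePt r k)).norm.integrable_sq

theorem integral_norm_sq_circleVec (hF : MemLp F 2 haarAddCircle) :
    ∫ θ, ∑ k, ‖circleVec r F θ k‖ ^ 2 ∂haarAddCircle = r * ∫ θ, ‖F θ‖ ^ 2 ∂haarAddCircle := by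
  rw [integral_finsetSum _ fun k _ => integrable_norm_sq_circleVec hF k]
  have h1 : ∀ k : Fin r, ∫ θ, ‖circleVec r F θ k‖ ^ 2 ∂haarAddCircle =
      ∫ θ, ‖F θ‖ ^ 2 ∂haarAddCircle := fun k =>
    integral_add_right_eq_self (μ := haarAddCircle) (fun t => ‖F t‖ ^ 2) (circlePt r k)
  simp [h1]

theorem integral_sampleEnergy_le (hr : 0 < r) (hg : ∀ j, MemLp (g j) ⊤ haarAddCircle)
    (hF : MemLp F 2 haarAddCircle) {M : ℝ}
    (h : ∀ᵐ θ ∂haarAddCircle, ∀ v : Fin r → ℂ,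
      ∑ j, ‖((circleMatrix r g θ).mulVec v) j‖ ^ 2 ≤ M * ∑ k, ‖v k‖ ^ 2) :
    ∫ θ, sampleEnergy r g F θ ∂haarAddCircle ≤ M * (r * ∫ θ, ‖F θ‖ ^ 2 ∂haarAddCircle) := by
  rw [← integral_norm_sq_circleVec hF, ← integral_const_mul]
  exact integral_mono_ae (integrable_sampleEnergy hr hg hF)
    ((integrable_finsetSum _ fun k _ => integrable_norm_sq_circleVec hF k).const_mul _)
    (h.mono fun θ hθ => hθ _)

theorem le_integral_sampleEnergy (hr : 0 < r) (hg : ∀ j, MemLp (g j) ⊤ haarAddCircle)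
    (hF : MemLp F 2 haarAddCircle) {c : ℝ}
    (h : ∀ᵐ θ ∂haarAddCircle, ∀ v : Fin r → ℂ,
      c * ∑ k, ‖v k‖ ^ 2 ≤ ∑ j, ‖((circleMatrix r g θ).mulVec v) j‖ ^ 2) :
    c * (r * ∫ θ, ‖F θ‖ ^ 2 ∂haarAddCircle) ≤ ∫ θ, sampleEnergy r g F θ ∂haarAddCircle := by
  rw [← integral_norm_sq_circleVec hF, ← integral_const_mul]
  exact integral_mono_ae
    ((integrable_finsetSum _ fun k _ => integrable_norm_sq_circleVec hF k).const_mul _)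
    (integrable_sampleEnergy hr hg hF) (h.mono fun θ hθ => hθ _)

end Fourier

/-! ### From integrated to pointwise lower bounds -/

section LowerBound

open AddCircle (haarAddCircle)

theorem exists_measurable_section :
    ∃ e : UnitAddCircle → ℝ, Measurable e ∧ ∀ y ∈ Set.Ico (0 : ℝ) 1, e (y : UnitAddCircle) = y := by
  refine ⟨_, measurable_subtype_coe.comp (AddCircle.measurableEquivIco 1 0).measurable,
    fun y hy => ?_⟩
  have h := AddCircle.coe_equivIco_mk_apply (1 : ℝ) y
  rw [div_one, mul_one, Int.fract_eq_self.2 hy] at h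
  exact h

variable {s r : ℕ}

/-- A bounded measurable function on the circle with prescribed constant values on the arcs
`(k / r, (k + 1) / r)`. -/
theorem exists_stepFunction (hr : 0 < r) (v : Fin r → ℂ) :
    ∃ F : UnitAddCircle → ℂ, Measurable F ∧ (∀ θ, ‖F θ‖ ≤ ∑ k, ‖v k‖) ∧
      ∀ x ∈ Set.Ioo (0 : ℝ) (1 / (r : ℝ)), circleVec r F (x : UnitAddCircle) = v := by
  obtain ⟨e, he, hey⟩ := exists_measurable_section
  have hr' : (0 : ℝ) < r := by exact_mod_cast hr
  -- The value `0` outside the range makes `w` total and keeps the norm bound valid at every point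
  -- of the circle.
  let w : ℕ → ℂ := fun n => if h : n < r then v ⟨n, h⟩ else 0
  refine ⟨fun θ => w ⌊e θ * r⌋₊, (measurable_from_top (f := w)).comp
    (Nat.measurable_floor.comp (he.mul_const (r : ℝ))), fun θ => ?_, fun x hx => ?_⟩
  · simp only [w]
    split_ifs with h
    · exact Finset.single_le_sum (f := fun k => ‖v k‖) (fun _ _ => norm_nonneg _)
        (Finset.mem_univ _)
    · simpa using Finset.sum_nonneg fun k _ => norm_nonneg (v k)
  · ext k
    have hk : ((k : ℕ) : ℝ) + 1 ≤ r := by exact_mod_cast k.2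
    have hx1 : x * r < 1 := by have := hx.2; rwa [lt_div_iff₀ hr'] at this
    have hx0 : 0 < x * r := mul_pos hx.1 hr'
    have hmul : (x + (k : ℝ) / (r : ℝ)) * r = x * r + k := by field_simp
    have h1 : e ((x : UnitAddCircle) + circlePt r k) = x + (k : ℝ) / (r : ℝ) := by
      rw [circlePt, ← AddCircle.coe_add]
      refine hey _ ⟨add_nonneg hx.1.le (by positivity), ?_⟩
      rw [← mul_lt_mul_iff_left₀ hr', hmul]; linarith
    have h2 : ⌊(x + (k : ℝ) / (r : ℝ)) * r⌋₊ = k := by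
      rw [hmul, Nat.floor_eq_iff (by positivity)]
      constructor <;> linarith
    simp only [circleVec, h1, h2, w]
    simp

variable {g : Fin s → UnitAddCircle → ℂ}

theorem measurable_sampleEnergy (hg : ∀ j, Measurable (g j)) {F : UnitAddCircle → ℂ}
    (hF : Measurable F) : Measurable (sampleEnergy r g F) := by
  unfold sampleEnergy
  refine Finset.measurable_sum _ fun j _ => Measurable.pow_const (Measurable.norm ?_) 2
  simp only [Matrix.mulVec, dotProduct, circleMatrix, Matrix.of_apply, circleVec]
  refine Finset.measurable_sum _ fun k _ => ?_
  exact ((hg j).comp (measurable_add_const _)).mul (hF.comp (measurable_add_const _))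

theorem sampleEnergy_add [NeZero r] (F : UnitAddCircle → ℂ) (θ : UnitAddCircle) (m : Fin r) :
    sampleEnergy r g F (θ + circlePt r m) = sampleEnergy r g F θ := by
  simp only [sampleEnergy, circleVec_add, circleMatrix_add_mulVec]

theorem sum_norm_sq_circleVec_add [NeZero r] (F : UnitAddCircle → ℂ) (θ : UnitAddCircle)
    (m : Fin r) :
    ∑ k, ‖circleVec r F (θ + circlePt r m) k‖ ^ 2 = ∑ k, ‖circleVec r F θ k‖ ^ 2 := by
  rw [circleVec_add]
  exact Fintype.sum_equiv (Equiv.addRight m) _ _ fun k => rfl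

/-- Localization: a lower bound for the integrated sample energy yields a pointwise bound. -/
theorem ae_le_sampleEnergy (hr : 0 < r) (hgm : ∀ j, Measurable (g j))
    (hg : ∀ j, MemLp (g j) ⊤ haarAddCircle) {c : ℝ}
    (h : ∀ F, MemLp F 2 haarAddCircle →
      c * (r * ∫ θ, ‖F θ‖ ^ 2 ∂haarAddCircle) ≤ ∫ θ, sampleEnergy r g F θ ∂haarAddCircle)
    {F : UnitAddCircle → ℂ} (hFm : Measurable F) (hF : MemLp F 2 haarAddCircle) :
    ∀ᵐ θ ∂haarAddCircle, c * ∑ k, ‖circleVec r F θ k‖ ^ 2 ≤ sampleEnergy r g F θ := by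
  have : NeZero r := ⟨hr.ne'⟩
  set f : UnitAddCircle → ℝ := fun θ =>
    c * ∑ k, ‖circleVec r F θ k‖ ^ 2 - sampleEnergy r g F θ with hf
  have hfm : Measurable f := by
    refine Measurable.sub (Measurable.const_mul ?_ _) (measurable_sampleEnergy hgm hFm)
    exact Finset.measurable_sum _ fun k _ =>
      (hFm.comp (measurable_add_const _)).norm.pow_const 2
  have hfper : ∀ θ (m : Fin r), f (θ + circlePt r m) = f θ := fun θ m => by
    simp only [hf, sampleEnergy_add, sum_norm_sq_circleVec_add]
  -- `E` is the set where the pointwise bound fails. It is invariant under translation by `m / r`,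
  -- so cutting `F` off to `E` keeps or kills the whole vector of translates at once. The integrated
  -- hypothesis for the truncated function then gives `∫_E f ≤ 0` with `f > 0` on `E`, so `E` is
  -- null.
  set E : Set UnitAddCircle := {θ | 0 < f θ} with hE
  have hEm : MeasurableSet E := measurableSet_lt measurable_const hfm
  have hF' : MemLp (E.indicator F) 2 haarAddCircle := hF.indicator hEm
  have hvec : ∀ θ, circleVec r (E.indicator F) θ = if θ ∈ E then circleVec r F θ else 0 := by
    intro θ
    have hiff : ∀ m : Fin r, θ + circlePt r m ∈ E ↔ θ ∈ E := fun m => by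
      change 0 < f _ ↔ 0 < f θ
      rw [hfper]
    ext k
    by_cases hθ : θ ∈ E
    · simp [circleVec, Set.indicator, hiff, hθ]
    · simp [circleVec, Set.indicator, hiff, hθ]
  have hint : ∫ θ, E.indicator f θ ∂haarAddCircle ≤ 0 := by
    have h1 := h _ hF'
    rw [← integral_norm_sq_circleVec hF', ← integral_const_mul, ← sub_nonpos, ← integral_sub
      ((integrable_finsetSum _ fun k _ => integrable_norm_sq_circleVec hF' k).const_mul _)
      (integrable_sampleEnergy hr hg hF')] at h1
    refine le_trans (le_of_eq (integral_congr_ae (Filter.Eventually.of_forall fun θ => ?_))) h1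
    by_cases hθ : θ ∈ E
    · simp [hvec, hθ, hf, sampleEnergy]
    · simp [hvec, hθ, sampleEnergy]
  have hnn : 0 ≤ E.indicator f := fun θ => Set.indicator_nonneg (fun θ hθ => le_of_lt hθ) θ
  have hfi : Integrable f haarAddCircle :=
    ((integrable_finsetSum _ fun k _ => integrable_norm_sq_circleVec hF k).const_mul _).sub
      (integrable_sampleEnergy hr hg hF)
  have hzero := (integral_eq_zero_iff_of_nonneg hnn (hfi.indicator hEm)).1
    (le_antisymm hint (integral_nonneg hnn))
  filter_upwards [hzero] with θ hθ
  by_contra hcon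
  have hmem : θ ∈ E := by simpa [hE, hf] using hcon
  rw [Set.indicator_of_mem hmem] at hθ
  exact (ne_of_gt hmem) hθ

/-- Testing with a step function realizes any fixed `v` on the whole interval. The exceptional null
set depends on `v`, so a countable dense set of vectors is used and the inequality, being closed in
`v`, extends to all of them. -/
theorem ae_le_mulVec_of_integral (hr : 0 < r) (hgm : ∀ j, Measurable (g j))
    (hg : ∀ j, MemLp (g j) ⊤ haarAddCircle) {c : ℝ}
    (h : ∀ F, MemLp F 2 haarAddCircle →
      c * (r * ∫ θ, ‖F θ‖ ^ 2 ∂haarAddCircle) ≤ ∫ θ, sampleEnergy r g F θ ∂haarAddCircle) :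
    ∀ᵐ (x : ℝ) ∂volume.restrict (Set.Ioo (0 : ℝ) (1 / (r : ℝ))), ∀ v : Fin r → ℂ,
      c * ∑ k, ‖v k‖ ^ 2 ≤ ∑ j, ‖((circleMatrix r g (x : UnitAddCircle)).mulVec v) j‖ ^ 2 := by
  have h1 : ∀ v : Fin r → ℂ, ∀ᵐ (x : ℝ) ∂volume.restrict (Set.Ioo (0 : ℝ) (1 / (r : ℝ))),
      c * ∑ k, ‖v k‖ ^ 2 ≤
        ∑ j, ‖((circleMatrix r g (x : UnitAddCircle)).mulVec v) j‖ ^ 2 := fun v => by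
    obtain ⟨F, hFm, hFb, hFv⟩ := exists_stepFunction hr v
    have hF : MemLp F 2 haarAddCircle :=
      MemLp.of_bound hFm.aestronglyMeasurable _ (Filter.Eventually.of_forall hFb)
    have h2 := ae_coe_add (ae_le_sampleEnergy hr hgm hg h hFm hF) hr 0
    filter_upwards [h2, ae_restrict_mem measurableSet_Ioo] with x hx hx'
    rw [add_zero] at hx
    simpa only [sampleEnergy, hFv x hx'] using hx
  have h2 := ae_all_iff.2 fun n : ℕ => h1 (TopologicalSpace.denseSeq (Fin r → ℂ) n)
  filter_upwards [h2] with x hx v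
  have hcl : IsClosed {v : Fin r → ℂ | c * ∑ k, ‖v k‖ ^ 2 ≤
      ∑ j, ‖((circleMatrix r g (x : UnitAddCircle)).mulVec v) j‖ ^ 2} := by
    refine isClosed_le (by fun_prop) ?_
    simp only [Matrix.mulVec, dotProduct]
    fun_prop
  exact (TopologicalSpace.denseRange_denseSeq (Fin r → ℂ)).induction_on v hcl hx

end LowerBound

/-! ### Essential bounds of the symbols and of the eigenvalues -/

section Symbols

open AddCircle (haarAddCircle)

variable {s r : ℕ} (g : Fin s → L2Circle)

theorem measurable_coe_L2Circle (f : L2Circle) : Measurable f :=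
  (Lp.stronglyMeasurable f).measurable

theorem exists_ae_norm_le_of_memLp_top {f : UnitAddCircle → ℂ} (hf : MemLp f ⊤ haarAddCircle) :
    ∃ M : ℝ, ∀ᵐ θ ∂haarAddCircle, ‖f θ‖ ≤ M := by
  refine ⟨(eLpNorm f ⊤ haarAddCircle).toReal, ?_⟩
  have h := ae_le_eLpNormEssSup (f := f) (μ := haarAddCircle)
  filter_upwards [h] with θ hθ
  rw [← eLpNorm_exponent_top] at hθ
  simpa using ENNReal.toReal_mono hf.2.ne hθ

/-- The largest eigenvalue of `G* G` dominates every squared entry of `G` and is at most `s r` times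
any common bound for those squares. The columns of `G` on `(0, 1/r)` see all of the circle up to a
null set. -/
theorem memLp_top_iff_betaG_lt_top (hr : 0 < r) :
    (∀ j, MemLp (g j) ⊤ haarAddCircle) ↔ betaG r g < ⊤ := by
  constructor
  · intro h
    have h1 : ∃ M : ℝ, ∀ j, ∀ᵐ θ ∂haarAddCircle, ‖g j θ‖ ≤ M := by
      choose M hM using fun j => exists_ae_norm_le_of_memLp_top (h j)
      refine ⟨∑ j, |M j|, fun j => (hM j).mono fun θ hθ => hθ.trans ((le_abs_self _).trans ?_)⟩
      exact Finset.single_le_sum (f := fun j => |M j|) (fun _ _ => abs_nonneg _)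
        (Finset.mem_univ j)
    obtain ⟨M, hM⟩ := h1
    refine lt_of_le_of_lt (essSup_le_of_ae_le (ENNReal.ofReal (s * r * M ^ 2)) ?_)
      ENNReal.ofReal_lt_top
    have h2 := ae_all_iff.2 fun j => ae_all_iff.2 fun k : Fin r =>
      ae_coe_add (hM j) hr ((k : ℝ) / (r : ℝ))
    filter_upwards [h2] with x hx
    exact ENNReal.ofReal_le_ofReal (lambdaMax_le_of_norm_entry_le _ hr hx)
  · intro h j
    have h1 : ∀ᵐ (x : ℝ) ∂volume.restrict (Set.Ioo (0 : ℝ) (1 / (r : ℝ))),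
        ENNReal.ofReal (lambdaMax (polyMatrix r g x)) ≤ betaG r g := ae_le_essSup
    refine memLp_top_of_bound (Lp.aestronglyMeasurable (g j))
      (Real.sqrt (betaG r g).toReal) (ae_of_ae_coe_add hr fun k => ?_)
    filter_upwards [h1] with x hx
    refine Real.le_sqrt_of_sq_le ?_
    refine (norm_sq_entry_le_lambdaMax (polyMatrix r g x) hr j k).trans ?_
    exact (ENNReal.ofReal_le_iff_le_toReal h.ne).1 hx

theorem exists_bound_mulVec (hr : 0 < r) (hg : ∀ j, MemLp (g j) ⊤ haarAddCircle) :
    ∃ M : ℝ, 0 < M ∧ ∀ᵐ θ ∂haarAddCircle, ∀ v : Fin r → ℂ,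
      ∑ j, ‖((circleMatrix r (fun j => g j) θ).mulVec v) j‖ ^ 2 ≤ M * ∑ k, ‖v k‖ ^ 2 := by
  choose M hM using fun j => exists_ae_norm_le_of_memLp_top (hg j)
  have h1 : ∀ᵐ θ ∂haarAddCircle, ∀ j, ∀ k : Fin r, ‖g j (θ + circlePt r k)‖ ≤ ∑ j, |M j| := by
    refine ae_all_iff.2 fun j => ae_all_iff.2 fun k => ?_
    have := (measurePreserving_add_right haarAddCircle
      (circlePt r k)).quasiMeasurePreserving.tendsto_ae.eventually (hM j)
    refine this.mono fun θ hθ => hθ.trans ((le_abs_self _).trans ?_)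
    exact Finset.single_le_sum (f := fun j => |M j|) (fun _ _ => abs_nonneg _) (Finset.mem_univ j)
  refine ⟨s * r * (∑ j, |M j|) ^ 2 + 1, by positivity, h1.mono fun θ hθ v => ?_⟩
  refine ((lambdaMax_le_iff _ hr).1 (lambdaMax_le_of_norm_entry_le
    (circleMatrix r (fun j => g j) θ) hr hθ) v).trans ?_
  gcongr
  linarith

theorem alphaG_pos_iff (hr : 0 < r) : 0 < alphaG r g ↔
    ∃ c : ℝ, 0 < c ∧ ∀ᵐ (x : ℝ) ∂volume.restrict (Set.Ioo (0 : ℝ) (1 / (r : ℝ))), ∀ v : Fin r → ℂ,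
      c * ∑ k, ‖v k‖ ^ 2 ≤
        ∑ j, ‖((circleMatrix r (fun j => g j) (x : UnitAddCircle)).mulVec v) j‖ ^ 2 := by
  simp only [← polyMatrix_eq, ← le_lambdaMin_iff _ hr]
  constructor
  · intro h
    obtain ⟨c, hc0, hc⟩ := exists_between h
    have hctop : c ≠ ⊤ := ne_top_of_lt hc
    refine ⟨c.toReal, ENNReal.toReal_pos hc0.ne' hctop, ?_⟩
    filter_upwards [ae_lt_of_lt_essInf hc] with x hx
    by_contra hcon
    rw [not_le] at hcon
    have := ENNReal.ofReal_le_ofReal hcon.le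
    rw [ENNReal.ofReal_toReal hctop] at this
    exact absurd hx (not_lt.2 this)
  · rintro ⟨c, hc, h⟩
    refine lt_of_lt_of_le (ENNReal.ofReal_pos.2 hc) (le_essInf_of_ae_le _ ?_)
    filter_upwards [h] with x hx
    exact ENNReal.ofReal_le_ofReal hx

/-- The bound is invariant under translation by `m / r`: permuting the columns of the matrix is
undone by permuting the arbitrary vector `v`. -/
theorem ae_circle_of_ae_Ioo (hr : 0 < r) {g : Fin s → UnitAddCircle → ℂ} {c : ℝ}
    (h : ∀ᵐ (x : ℝ) ∂volume.restrict (Set.Ioo (0 : ℝ) (1 / (r : ℝ))), ∀ v : Fin r → ℂ,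
      c * ∑ k, ‖v k‖ ^ 2 ≤
        ∑ j, ‖((circleMatrix r g (x : UnitAddCircle)).mulVec v) j‖ ^ 2) :
    ∀ᵐ θ ∂haarAddCircle, ∀ v : Fin r → ℂ, c * ∑ k, ‖v k‖ ^ 2 ≤
        ∑ j, ‖((circleMatrix r g θ).mulVec v) j‖ ^ 2 := by
  have : NeZero r := ⟨hr.ne'⟩
  refine ae_of_ae_coe_add hr fun m => ?_
  filter_upwards [h] with x hx v
  have h1 := circleMatrix_add_mulVec g (x : UnitAddCircle) m fun k => v (k - m)
  simp only [add_sub_cancel_right] at h1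
  rw [AddCircle.coe_add]
  change _ ≤ ∑ j, ‖((circleMatrix r g (x + circlePt r m)).mulVec v) j‖ ^ 2
  rw [h1]
  refine le_trans (le_of_eq ?_) (hx _)
  congr 1
  exact (Fintype.sum_equiv (Equiv.subRight m) _ _ fun k => rfl).symm

end Symbols

/-! ### The circle model of the first factor -/

section Riesz

open AddCircle (haarAddCircle)

variable {H : Type*} [NormedAddCommGroup H] [InnerProductSpace ℂ H]

theorem IsRieszSequence.exists_equiv {x : ℤ → H} (hx : IsRieszSequence x) :
    ∃ Ψ : L2Circle ≃L[ℂ] closedSpan x, ∀ n, (Ψ (fourierLp 2 n) : H) = x n := by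
  obtain ⟨e, T, hT⟩ := hx
  refine ⟨(fourierBasis.repr.trans e.repr.symm).toContinuousLinearEquiv.trans T, fun n => ?_⟩
  have h1 : (fourierLp 2 n : L2Circle) = fourierBasis n := by rw [coe_fourierBasis]
  classical
  rw [← hT n, h1]
  change ((T (e.repr.symm (fourierBasis.repr (fourierBasis n))) : closedSpan x) : H) = _
  rw [HilbertBasis.repr_self, HilbertBasis.repr_symm_single]

theorem memLp_fourier (n : ℤ) :
    MemLp (fun θ : UnitAddCircle => (fourier n θ : ℂ)) 2 haarAddCircle :=
  MemLp.of_bound (fourier n).continuous.aestronglyMeasurable ‖(fourier n : C(UnitAddCircle, ℂ))‖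
    (Filter.Eventually.of_forall fun θ => (fourier n).norm_coe_le_norm θ)

theorem norm_sq_toLp {F : UnitAddCircle → ℂ} (hF : MemLp F 2 haarAddCircle) :
    ‖hF.toLp F‖ ^ 2 = ∫ θ, ‖F θ‖ ^ 2 ∂haarAddCircle := by
  have h1 := L2.inner_def (𝕜 := ℂ) (hF.toLp F) (hF.toLp F)
  rw [inner_self_eq_norm_sq_to_K] at h1
  have h2 : ∫ θ, inner ℂ (hF.toLp F θ) (hF.toLp F θ) ∂haarAddCircle =
      ∫ θ, ((‖F θ‖ ^ 2 : ℝ) : ℂ) ∂haarAddCircle := by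
    refine integral_congr_ae ?_
    filter_upwards [hF.coeFn_toLp] with θ hθ
    rw [hθ, inner_self_eq_norm_sq_to_K]
    simp
  rw [h2, integral_complex_ofReal] at h1
  exact Complex.ofReal_injective (by push_cast; exact h1)

theorem fourierCoeff_mul_fourier (g : UnitAddCircle → ℂ) (n k : ℤ) :
    fourierCoeff (fun θ => g θ * fourier k θ) n = fourierCoeff g (n - k) := by
  simp only [fourierCoeff]
  congr 1
  ext θ
  have : (fourier (-(n - k)) θ : ℂ) = fourier (-n) θ * fourier k θ := by
    rw [← fourier_add]; congr 2; ring
  rw [this, smul_eq_mul, smul_eq_mul]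
  ring

variable (U : H ≃ₗᵢ[ℂ] H) (a : H)

theorem zpow_add_apply (m n : ℤ) (u : H) : (U ^ (m + n)) u = (U ^ m) ((U ^ n) u) := by
  rw [zpow_add]; rfl

theorem inner_zpow_zpow (m n : ℤ) (u v : H) :
    inner ℂ ((U ^ m) u) ((U ^ n) v) = inner ℂ ((U ^ (m - n)) u) v := by
  rw [← LinearIsometryEquiv.inner_map_map (U ^ n) ((U ^ (m - n)) u), ← zpow_add_apply,
    add_sub_cancel]

variable {U a} [CompleteSpace H] (ha : IsRieszSequence fun n : ℤ => (U ^ n) a)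

include ha in
theorem fourierCoeff_symbol (h : H) (n : ℤ) :
    fourierCoeff (symbol U a h) n = inner ℂ ((U ^ n) h) a := by
  have h1 := (innerSL ℂ (fourierLp 2 n : L2Circle)).hasSum (summable_symbol U a h ha).hasSum
  have h2 : ∀ k, innerSL ℂ (fourierLp 2 n : L2Circle)
      ((inner ℂ ((U ^ k) h) a : ℂ) • (fourierLp 2 k : L2Circle)) =
      if k = n then inner ℂ ((U ^ n) h) a else 0 := fun k => by
    rw [innerSL_apply_apply, inner_smul_right, orthonormal_iff_ite.1 orthonormal_fourier n k]
    split_ifs with h3 h4 h4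
    · rw [h3, mul_one]
    · exact absurd h3.symm h4
    · exact absurd h4.symm h3
    · rw [mul_zero]
  simp only [h2] at h1
  have h3 := h1.unique (hasSum_ite_eq n _)
  rw [← fourierBasis_repr, HilbertBasis.repr_apply_apply, coe_fourierBasis]
  exact h3

include ha in
-- Boundedness of the symbol makes the right side a continuous functional of `F`, namely the pairing
-- with `e_n` times the conjugate symbol. Both sides are then continuous and it suffices to compare
-- them on the Fourier basis.
theorem inner_zpow_eq_fourierCoeff {h : H} (hg : MemLp (symbol U a h) ⊤ haarAddCircle)
    {Ψ : L2Circle ≃L[ℂ] closedSpan fun n : ℤ => (U ^ n) a}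
    (hΨ : ∀ n, (Ψ (fourierLp 2 n) : H) = (U ^ n) a) {F : UnitAddCircle → ℂ}
    (hF : MemLp F 2 haarAddCircle) (n : ℤ) :
    inner ℂ ((U ^ n) h) (Ψ (hF.toLp F) : H) =
      fourierCoeff (fun θ => symbol U a h θ * F θ) n := by
  have hw : MemLp (fun θ => fourier n θ * star (symbol U a h θ)) 2 haarAddCircle := by
    have h1 : MemLp (fun θ => star (symbol U a h θ)) ⊤ haarAddCircle := hg.star
    have h2 : MemLp (fun θ : UnitAddCircle => (fourier n θ : ℂ)) 2 haarAddCircle :=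
      memLp_fourier n
    exact h1.mul h2
  have key : ∀ {f : UnitAddCircle → ℂ} (hf : MemLp f 2 haarAddCircle),
      inner ℂ (hw.toLp _) (hf.toLp f) =
        fourierCoeff (fun θ => symbol U a h θ * f θ) n := fun {f} hf => by
    rw [L2.inner_def, fourierCoeff]
    refine integral_congr_ae ?_
    filter_upwards [hw.coeFn_toLp, hf.coeFn_toLp] with θ h1 h2
    rw [h1, h2, RCLike.inner_apply, map_mul, smul_eq_mul, fourier_neg]
    simp
    ring
  have heq : (innerSL ℂ ((U ^ n) h)) ∘L (closedSpan fun n : ℤ => (U ^ n) a).subtypeL ∘L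
      (Ψ : L2Circle →L[ℂ] closedSpan fun n : ℤ => (U ^ n) a) = innerSL ℂ (hw.toLp _) := by
    refine ContinuousLinearMap.ext_on (s := Set.range (fourierBasis (T := (1 : ℝ)))) ?_ ?_
    · rw [Submodule.dense_iff_topologicalClosure_eq_top]
      exact fourierBasis.dense_span
    · rintro _ ⟨k, rfl⟩
      have hk : MemLp (fun θ : UnitAddCircle => (fourier k θ : ℂ)) 2 haarAddCircle :=
        memLp_fourier k
      have hk' : (fourierLp 2 k : L2Circle) = hk.toLp _ := by
        refine Lp.ext ?_
        filter_upwards [coeFn_fourierLp 2 k, hk.coeFn_toLp] with θ h1 h2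
        rw [h1, h2]
      rw [coe_fourierBasis, innerSL_apply_apply, hk', key, fourierCoeff_mul_fourier,
        fourierCoeff_symbol ha, ← hk', ← inner_zpow_zpow, ← hΨ]
      rfl
  rw [← key hF]
  exact congrArg (fun T : L2Circle →L[ℂ] ℂ => T (hF.toLp F)) heq

variable {s r : ℕ} {h : Fin s → H}

include ha in
theorem hasSum_norm_sq_sample (hr : 0 < r)
    (hg : ∀ j, MemLp (symbol U a (h j)) ⊤ haarAddCircle)
    {Ψ : L2Circle ≃L[ℂ] closedSpan fun n : ℤ => (U ^ n) a}
    (hΨ : ∀ n, (Ψ (fourierLp 2 n) : H) = (U ^ n) a) {F : UnitAddCircle → ℂ}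
    (hF : MemLp F 2 haarAddCircle) :
    HasSum (fun p : Fin s × ℤ => ‖inner ℂ ((U ^ (r * p.2)) (h p.1)) (Ψ (hF.toLp F) : H)‖ ^ 2)
      (((r : ℝ) ^ 2)⁻¹ *
        ∫ θ, sampleEnergy r (fun j => symbol U a (h j)) F θ ∂haarAddCircle) := by
  have h1 := hasSum_sampleEnergy (g := fun j => symbol U a (h j)) hr hg hF
  refine h1.congr_fun fun p => ?_
  rw [inner_zpow_eq_fourierCoeff ha (hg p.1) hΨ hF]

include ha in
theorem exists_bessel_bound_samples (hr : 0 < r)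
    (hg : ∀ j, MemLp (symbol U a (h j)) ⊤ haarAddCircle) :
    ∃ B : ℝ, 0 < B ∧ ∀ u ∈ closedSpan fun n : ℤ => (U ^ n) a,
      Summable (fun p : Fin s × ℤ => ‖inner ℂ ((U ^ (r * p.2)) (h p.1)) u‖ ^ 2) ∧
      ∑' p : Fin s × ℤ, ‖inner ℂ ((U ^ (r * p.2)) (h p.1)) u‖ ^ 2 ≤ B * ‖u‖ ^ 2 := by
  obtain ⟨Ψ, hΨ⟩ := ha.exists_equiv
  obtain ⟨M, hM0, hM⟩ := exists_bound_mulVec (r := r) (fun j => symbol U a (h j)) hr hg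
  have hr' : (0 : ℝ) < r := by exact_mod_cast hr
  set C := ‖(Ψ.symm : (closedSpan fun n : ℤ => (U ^ n) a) →L[ℂ] L2Circle)‖
  refine ⟨((r : ℝ) ^ 2)⁻¹ * (M * (r * C ^ 2)) + 1, by positivity, fun u hu => ?_⟩
  set f : L2Circle := Ψ.symm ⟨u, hu⟩ with hf
  have hF : MemLp f 2 haarAddCircle := Lp.memLp f
  have hu' : (Ψ (hF.toLp f) : H) = u := by rw [Lp.toLp_coeFn, hf]; simp
  have h1 := hasSum_norm_sq_sample ha hr hg hΨ hF
  rw [hu'] at h1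
  refine ⟨h1.summable, ?_⟩
  rw [h1.tsum_eq]
  have h2 := integral_sampleEnergy_le hr hg hF hM
  rw [← norm_sq_toLp hF, Lp.toLp_coeFn] at h2
  have h3 : ‖f‖ ^ 2 ≤ C ^ 2 * ‖u‖ ^ 2 := by
    rw [← mul_pow]
    gcongr
    exact (Ψ.symm : (closedSpan fun n : ℤ => (U ^ n) a) →L[ℂ] L2Circle).le_opNorm ⟨u, hu⟩
  calc ((r : ℝ) ^ 2)⁻¹ * _ ≤ ((r : ℝ) ^ 2)⁻¹ * (M * (r * (C ^ 2 * ‖u‖ ^ 2))) := by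
        gcongr
        refine h2.trans ?_
        gcongr
    _ ≤ _ := by nlinarith [sq_nonneg ‖u‖]

include ha in
theorem alphaG_pos_iff_exists_lower_bound (hr : 0 < r)
    (hg : ∀ j, MemLp (symbol U a (h j)) ⊤ haarAddCircle) :
    0 < alphaG r (fun j => symbol U a (h j)) ↔
    ∃ A : ℝ, 0 < A ∧ ∀ u ∈ closedSpan fun n : ℤ => (U ^ n) a,
      A * ‖u‖ ^ 2 ≤ ∑' p : Fin s × ℤ, ‖inner ℂ ((U ^ (r * p.2)) (h p.1)) u‖ ^ 2 := by
  obtain ⟨Ψ, hΨ⟩ := ha.exists_equiv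
  have hr' : (0 : ℝ) < r := by exact_mod_cast hr
  rw [alphaG_pos_iff _ hr]
  constructor
  · rintro ⟨c, hc0, hc⟩
    -- Adding `1` makes the constant positive, so it can be inverted without showing that the
    -- operator is nonzero.
    set C := ‖(Ψ : L2Circle →L[ℂ] closedSpan fun n : ℤ => (U ^ n) a)‖ + 1
    have hC : 0 < C := by positivity
    refine ⟨((r : ℝ) ^ 2)⁻¹ * (c * (r * (C ^ 2)⁻¹)), by positivity, fun u hu => ?_⟩
    set f : L2Circle := Ψ.symm ⟨u, hu⟩ with hf
    have hF : MemLp f 2 haarAddCircle := Lp.memLp f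
    have hu' : (Ψ (hF.toLp f) : H) = u := by rw [Lp.toLp_coeFn, hf]; simp
    have h1 := hasSum_norm_sq_sample ha hr hg hΨ hF
    rw [hu'] at h1
    rw [h1.tsum_eq]
    have h2 := le_integral_sampleEnergy hr hg hF (ae_circle_of_ae_Ioo hr hc)
    rw [← norm_sq_toLp hF, Lp.toLp_coeFn] at h2
    have h3 : ‖u‖ ^ 2 ≤ C ^ 2 * ‖f‖ ^ 2 := by
      rw [← mul_pow]
      gcongr
      have h4 := (Ψ : L2Circle →L[ℂ] closedSpan fun n : ℤ => (U ^ n) a).le_opNorm f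
      have h5 : ‖(Ψ : L2Circle →L[ℂ] closedSpan fun n : ℤ => (U ^ n) a) f‖ = ‖u‖ := by simp [hf]
      rw [h5] at h4
      exact h4.trans (by gcongr; simp [C])
    rw [mul_assoc]
    gcongr
    refine le_trans ?_ h2
    rw [mul_assoc, mul_assoc]
    gcongr
    rwa [inv_mul_le_iff₀ (by positivity)]
  · rintro ⟨A, hA0, hA⟩
    set C := ‖(Ψ.symm : (closedSpan fun n : ℤ => (U ^ n) a) →L[ℂ] L2Circle)‖ + 1
    have hC : 0 < C := by positivity
    -- The energy formula contributes `r ^ 2`, while the vector of translates has integrated squared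
    -- norm `r ∫ ‖F‖²`; one factor `r` remains.
    refine ⟨A * (C ^ 2)⁻¹ * r, by positivity, ?_⟩
    refine ae_le_mulVec_of_integral hr (fun j => measurable_coe_L2Circle _) hg fun F hF => ?_
    have h1 := hasSum_norm_sq_sample ha hr hg hΨ hF
    have h2 := hA _ (Ψ (hF.toLp F)).2
    rw [h1.tsum_eq, le_inv_mul_iff₀ (by positivity)] at h2
    refine le_trans ?_ h2
    have h3 : ‖hF.toLp F‖ ^ 2 ≤ C ^ 2 * ‖(Ψ (hF.toLp F) : H)‖ ^ 2 := by
      rw [← mul_pow]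
      gcongr
      have h4 := (Ψ.symm : (closedSpan fun n : ℤ => (U ^ n) a) →L[ℂ] L2Circle).le_opNorm (Ψ (hF.toLp F))
      rw [ContinuousLinearEquiv.coe_coe, ContinuousLinearEquiv.symm_apply_apply] at h4
      exact h4.trans (mul_le_mul_of_nonneg_right (by simp [C]) (norm_nonneg _))
    rw [← norm_sq_toLp hF]
    rw [← inv_mul_le_iff₀ (by positivity)] at h3
    calc A * (C ^ 2)⁻¹ * r * (r * ‖hF.toLp F‖ ^ 2)
        = (r : ℝ) ^ 2 * (A * ((C ^ 2)⁻¹ * ‖hF.toLp F‖ ^ 2)) := by ring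
      _ ≤ _ := by gcongr

end Riesz

/-! ### Dual frames of orbits, and the periodic second factor -/

section Orbits

variable {H : Type*} [NormedAddCommGroup H] [InnerProductSpace ℂ H]

/-- Dual frames of orbits: if the orbits of the vectors `h j` under a group acting unitarily on `K`
satisfy frame inequalities on `K`, then there is a dual frame of the same orbit form. -/
theorem exists_dual_orbit [CompleteSpace H] {J Γ : Type*} [AddGroup Γ] {K : Submodule ℂ H}
    (hK : IsClosed (K : Set H)) (W : Γ → H ≃ₗᵢ[ℂ] H) (hW : ∀ γ, ∀ u ∈ K, W γ u ∈ K)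
    (hW' : ∀ γ, ∀ u ∈ K, (W γ).symm u ∈ K)
    (hWadd : ∀ γ δ, ∀ u ∈ K, W (γ + δ) u = W γ (W δ u)) (h : J → H) {A B : ℝ} (hA : 0 < A)
    (hB : 0 < B)
    (hbes : ∀ u ∈ K, Summable (fun p : J × Γ => ‖inner ℂ (W p.2 (h p.1)) u‖ ^ 2) ∧
      ∑' p : J × Γ, ‖inner ℂ (W p.2 (h p.1)) u‖ ^ 2 ≤ B * ‖u‖ ^ 2)
    (hlow : ∀ u ∈ K, A * ‖u‖ ^ 2 ≤ ∑' p : J × Γ, ‖inner ℂ (W p.2 (h p.1)) u‖ ^ 2) :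
    ∃ c : J → H, (∀ j, c j ∈ K) ∧
      (∀ u ∈ K, HasSum (fun p : J × Γ => inner ℂ (W p.2 (h p.1)) u • W p.2 (c p.1)) u) ∧
      ∃ B', 0 < B' ∧ IsBessel (fun p : J × Γ => W p.2 (c p.1)) B' := by
  have : CompleteSpace K := hK.completeSpace_coe
  set P := K.starProjection with hP
  have hPK : ∀ y, P y ∈ K := fun y => by simp [hP]
  have hPW : ∀ γ y, P (W γ y) = W γ (P y) := fun γ y =>
    starProjection_commute_of_mapsTo (W γ) (hW γ) (hW' γ) y
  have hPin : ∀ y, ∀ u ∈ K, inner ℂ (P y) u = inner ℂ y u := fun y u hu => by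
    rw [hP, Submodule.inner_starProjection_left_eq_right,
      Submodule.starProjection_eq_self_iff.2 hu]
  have hbes' : IsBessel (fun p : J × Γ => P (W p.2 (h p.1))) B :=
    IsBessel.starProjection hB.le hbes
  obtain ⟨D, hDK, hDsum, hDW⟩ := exists_dualOp hK hbes' (fun p => hPK _) hA fun u hu => by
    simpa only [hPin _ u hu] using hlow u hu
  -- Each `W γ` permutes the projected frame by left translation of the group index, so `D` commutes
  -- with it and the dual is the orbit of the vectors `D (P (h j))`.
  have hDc : ∀ p : J × Γ, D (P (W p.2 (h p.1))) = W p.2 (D (P (h p.1))) := fun p => by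
    rw [hPW]
    refine hDW (W p.2) (hW _) (hW' _)
      ⟨(Equiv.refl J).prodCongr (Equiv.addLeft p.2), fun q => ?_⟩ _
    simp only [Equiv.prodCongr_apply, Equiv.coe_addLeft, hPW]
    exact hWadd _ _ _ (hPK _)
  refine ⟨fun j => D (P (h j)), fun j => hDK _ (hPK _), fun u hu => ?_, B * ‖D‖ ^ 2 + 1,
    by positivity, fun y => ?_⟩
  · have := hDsum u hu
    simpa only [hDc, hPin _ u hu] using this
  · have := hbes'.map hB.le D y
    simp only [hDc] at this
    exact ⟨this.1, this.2.trans (by nlinarith [sq_nonneg ‖y‖])⟩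

variable {V : H ≃ₗᵢ[ℂ] H} {b : H}

theorem zpow_apply_mem_closedSpan {x : ℤ → H} (hx : ∀ m n, (V ^ m) (x n) = x (m + n)) (m : ℤ)
    {u : H} (hu : u ∈ closedSpan x) : (V ^ m) u ∈ closedSpan x := by
  refine map_mem_of_mem_closedSpan (isClosed_closedSpan x)
    ((V ^ m : H ≃ₗᵢ[ℂ] H) : H →L[ℂ] H) (fun n => ?_) hu
  have := mem_closedSpan x (m + n)
  rwa [← hx] at this

theorem symm_zpow_apply (m : ℤ) (u : H) : (V ^ m).symm u = (V ^ (-m)) u := by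
  rw [zpow_neg]; rfl

theorem zpow_mul_apply_eq_self {N : ℕ} (hVb : (V ^ N) b = b) (k : ℤ) :
    (V ^ ((N : ℤ) * k)) b = b := by
  have h1 : (V ^ (N : ℤ)) b = b := by rwa [zpow_natCast]
  induction k using Int.induction_on with
  | zero => simp
  | succ k ih => rw [mul_add, mul_one, zpow_add_apply, h1, ih]
  | pred k ih =>
    have h2 : (V ^ (-(N : ℤ))) b = b := by
      conv_lhs => rw [← h1]
      rw [← zpow_add_apply, neg_add_cancel, zpow_zero]; rfl
    rw [mul_sub, mul_one, sub_eq_add_neg, zpow_add_apply, h2, ih]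

theorem zpow_apply_eq_pow_apply {N : ℕ} (hN : 0 < N) (hVb : (V ^ N) b = b) (q : ℤ) :
    ∃ p : Fin N, (V ^ q) b = (V ^ (p : ℕ)) b := by
  have hN' : (N : ℤ) ≠ 0 := by exact_mod_cast hN.ne'
  have h0 := Int.emod_nonneg q hN'
  have h1 := Int.emod_lt_of_pos q (by exact_mod_cast hN : (0 : ℤ) < N)
  refine ⟨⟨(q % N).toNat, by omega⟩, ?_⟩
  rw [← zpow_natCast, Int.toNat_of_nonneg h0]
  conv_lhs => rw [← Int.emod_add_mul_ediv q N, zpow_add_apply, zpow_mul_apply_eq_self hVb]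

variable {N : ℕ}

theorem zpow_apply_mem_closedSpan_fin (hN : 0 < N) (hVb : (V ^ N) b = b) (m : ℤ) {u : H}
    (hu : u ∈ closedSpan fun p : Fin N => (V ^ (p : ℕ)) b) :
    (V ^ m) u ∈ closedSpan fun p : Fin N => (V ^ (p : ℕ)) b := by
  refine map_mem_of_mem_closedSpan (isClosed_closedSpan _)
    ((V ^ m : H ≃ₗᵢ[ℂ] H) : H →L[ℂ] H) (fun p => ?_) hu
  obtain ⟨q, hq⟩ := zpow_apply_eq_pow_apply hN hVb (m + (p : ℕ))
  have := mem_closedSpan (fun p : Fin N => (V ^ (p : ℕ)) b) q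
  rw [← hq, zpow_add_apply, zpow_natCast] at this
  exact this

theorem zpow_mul_apply_of_mem_closedSpan (hVb : (V ^ N) b = b) (k : ℤ) {u : H}
    (hu : u ∈ closedSpan fun p : Fin N => (V ^ (p : ℕ)) b) : (V ^ ((N : ℤ) * k)) u = u := by
  refine map_eq_of_mem_closedSpan ((V ^ ((N : ℤ) * k) : H ≃ₗᵢ[ℂ] H) : H →L[ℂ] H)
    (ContinuousLinearMap.id ℂ H) (fun p => ?_) hu
  change (V ^ ((N : ℤ) * k)) ((V ^ (p : ℕ)) b) = (V ^ (p : ℕ)) b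
  rw [← zpow_natCast, ← zpow_add_apply, add_comm, zpow_add_apply, zpow_mul_apply_eq_self hVb]

theorem closedSpan_eq_span {ι : Type*} [Finite ι] (x : ι → H) :
    closedSpan x = Submodule.span ℂ (Set.range x) := by
  have := FiniteDimensional.span_of_finite ℂ (Set.finite_range x)
  exact (Submodule.closed_of_finiteDimensional _).submodule_topologicalClosure_eq

theorem sum_norm_sq_inner_le {κ : Type*} [Fintype κ] (g : κ → H) (v : H) :
    ∑ k, ‖inner ℂ (g k) v‖ ^ 2 ≤ (∑ k, ‖g k‖ ^ 2) * ‖v‖ ^ 2 := by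
  rw [Finset.sum_mul]
  refine Finset.sum_le_sum fun k _ => ?_
  rw [← mul_pow]
  gcongr
  exact norm_inner_le_norm _ _

/-- The closed span is finite dimensional, and an injective linear map on such a space is
antilipschitz. -/
theorem exists_lower_bound_of_finite {κ ι : Type*} [Fintype κ] [Finite ι] {x : ι → H} {g : κ → H}
    (h : ∀ v ∈ closedSpan x, (∀ k, inner ℂ (g k) v = 0) → v = 0) :
    ∃ A : ℝ, 0 < A ∧ ∀ v ∈ closedSpan x, A * ‖v‖ ^ 2 ≤ ∑ k, ‖inner ℂ (g k) v‖ ^ 2 := by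
  have hfd : FiniteDimensional ℂ (closedSpan x) := by
    rw [closedSpan_eq_span]
    exact FiniteDimensional.span_of_finite ℂ (Set.finite_range x)
  let L : closedSpan x →ₗ[ℂ] EuclideanSpace ℂ κ :=
    { toFun := fun v => WithLp.toLp 2 fun k => inner ℂ (g k) (v : H)
      map_add' := fun v w => by ext k; exact inner_add_right _ _ _
      map_smul' := fun c v => by ext k; exact inner_smul_right _ _ _ }
  have hL : L.ker = ⊥ := by
    rw [LinearMap.ker_eq_bot']
    intro v hv
    refine Subtype.ext (h v v.2 fun k => ?_)
    exact congrArg (fun w : EuclideanSpace ℂ κ => w k) hv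
  obtain ⟨C, hC0, hC⟩ := L.exists_antilipschitzWith hL
  have hC0' : (0 : ℝ) < C := hC0
  refine ⟨((C : ℝ) ^ 2)⁻¹, by positivity, fun v hv => ?_⟩
  have h1 := hC.le_mul_norm_sub (⟨v, hv⟩ : closedSpan x) 0
  simp only [map_zero, add_zero, norm_neg] at h1
  rw [inv_mul_le_iff₀ (by positivity)]
  have h2 : ‖L ⟨v, hv⟩‖ ^ 2 = ∑ k, ‖inner ℂ (g k) v‖ ^ 2 := EuclideanSpace.norm_sq_eq _
  rw [← h2, ← mul_pow]
  gcongr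
  exact h1

theorem rank_eq_iff_mulVec {m n : Type*} [Fintype m] [Fintype n] (M : Matrix m n ℂ) :
    M.rank = Fintype.card n ↔ ∀ c, M.mulVec c = 0 → c = 0 := by
  have h1 := M.mulVecLin.finrank_range_add_finrank_ker
  rw [Module.finrank_fintype_fun_eq_card] at h1
  have h2 : (∀ c, M.mulVec c = 0 → c = 0) ↔ M.mulVecLin.ker = ⊥ := by
    rw [LinearMap.ker_eq_bot']; rfl
  rw [h2, ← Submodule.finrank_eq_zero (R := ℂ), Matrix.rank]
  omega

/-- Since `V ^ N b = b`, the shift by `N` in the entries is harmless, and the matrix applied to `c`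
lists the samples of `∑ c_p V ^ p b`. Linear independence translates injectivity on coefficients
into injectivity on vectors. -/
theorem rank_crossCovMatrix_eq_iff (hVb : (V ^ N) b = b)
    (hb : LinearIndependent ℂ fun p : Fin N => (V ^ (p : ℕ)) b) (rbar : ℕ) {s' : ℕ}
    (h : Fin s' → H) : (crossCovMatrix V b N rbar h).rank = N ↔
      ∀ v ∈ closedSpan fun p : Fin N => (V ^ (p : ℕ)) b,
        (∀ k : Fin s' × Fin (N / rbar),
          inner ℂ ((V ^ ((rbar : ℤ) * ((k.2 : ℕ) : ℤ))) (h k.1)) v = 0) → v = 0 := by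
  have hmul : ∀ (c : Fin N → ℂ) (k : Fin s' × Fin (N / rbar)),
      (crossCovMatrix V b N rbar h).mulVec c k =
      inner ℂ ((V ^ ((rbar : ℤ) * ((k.2 : ℕ) : ℤ))) (h k.1)) (∑ p, c p • (V ^ (p : ℕ)) b) := by
    intro c k
    rw [inner_sum, Matrix.mulVec, dotProduct]
    refine Finset.sum_congr rfl fun p _ => ?_
    rw [inner_smul_right, mul_comm]
    congr 1
    simp only [crossCovMatrix, crossCov, Matrix.of_apply]
    rw [← LinearIsometryEquiv.inner_map_map (V ^ ((rbar : ℤ) * ((k.2 : ℕ) : ℤ))),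
      ← zpow_add_apply]
    congr 1
    have := zpow_mul_apply_eq_self hVb 1
    rw [mul_one] at this
    conv_rhs => rw [← this, ← zpow_natCast, ← zpow_add_apply]
    congr 2
    ring
  have hrank := rank_eq_iff_mulVec (crossCovMatrix V b N rbar h)
  rw [Fintype.card_fin] at hrank
  rw [hrank, closedSpan_eq_span]
  constructor
  · intro h1 v hv h2
    obtain ⟨c, rfl⟩ := (Submodule.mem_span_range_iff_exists_fun ℂ).1 hv
    rw [h1 c (funext fun k => by rw [hmul, h2]; rfl)]
    simp
  · intro h1 c hc
    have h2 := h1 (∑ p, c p • (V ^ (p : ℕ)) b)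
      (Submodule.sum_mem _ fun p _ => Submodule.smul_mem _ _ (Submodule.subset_span ⟨p, rfl⟩))
      fun k => by rw [← hmul, hc]; rfl
    exact funext (Fintype.linearIndependent_iff.1 hb c h2)

theorem IsFrameFor.comp_equiv {ι ι' : Type*} {K : Submodule ℂ H} {x : ι → H}
    (hx : IsFrameFor K x) (e : ι' ≃ ι) : IsFrameFor K fun i => x (e i) := by
  obtain ⟨h1, A, B, hA, hB, h⟩ := hx
  refine ⟨fun i => h1 _, A, B, hA, hB, fun y hy => ?_⟩
  rw [e.tsum_eq fun i => ‖inner ℂ (x i) y‖ ^ 2]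
  exact ⟨e.summable_iff.2 (h y hy).1, (h y hy).2⟩

end Orbits

/-! ### Orbit duals in each factor -/

section Duals

variable {H₁ H₂ : Type*} [NormedAddCommGroup H₁] [InnerProductSpace ℂ H₁] [CompleteSpace H₁]
  [NormedAddCommGroup H₂] [InnerProductSpace ℂ H₂] [CompleteSpace H₂]

open AddCircle (haarAddCircle)

theorem exists_dual_of_alphaG_pos {U : H₁ ≃ₗᵢ[ℂ] H₁} {a : H₁}
    (ha : IsRieszSequence fun n : ℤ => (U ^ n) a) {r s : ℕ} (hr : 0 < r) {h : Fin s → H₁}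
    (hg : ∀ j, MemLp (symbol U a (h j)) ⊤ haarAddCircle)
    (hα : 0 < alphaG r (fun j => symbol U a (h j))) :
    ∃ c : Fin s → H₁, (∀ j, c j ∈ closedSpan fun n : ℤ => (U ^ n) a) ∧
      (∀ u ∈ closedSpan fun n : ℤ => (U ^ n) a,
        HasSum (fun p : Fin s × ℤ => inner ℂ ((U ^ ((r : ℤ) * p.2)) (h p.1)) u •
          (U ^ ((r : ℤ) * p.2)) (c p.1)) u) ∧
      ∃ B', 0 < B' ∧ IsBessel (fun p : Fin s × ℤ => (U ^ ((r : ℤ) * p.2)) (c p.1)) B' := by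
  obtain ⟨A, hA, hlow⟩ := (alphaG_pos_iff_exists_lower_bound ha hr hg).1 hα
  obtain ⟨B, hB, hbes⟩ := exists_bessel_bound_samples ha hr hg
  have hmem : ∀ m : ℤ, ∀ u ∈ closedSpan fun n : ℤ => (U ^ n) a,
      (U ^ m) u ∈ closedSpan fun n : ℤ => (U ^ n) a := fun m u hu =>
    zpow_apply_mem_closedSpan (fun m n => (zpow_add_apply U m n a).symm) m hu
  refine exists_dual_orbit (isClosed_closedSpan _) (fun n : ℤ => U ^ ((r : ℤ) * n))
    (fun n => hmem _) (fun n u hu => ?_) (fun m n u _ => ?_) h hA hB hbes hlow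
  · rw [symm_zpow_apply]; exact hmem _ u hu
  · rw [mul_add, zpow_add_apply]

/-- The acting group is the cyclic group `Fin (N / rbar)`. Its additivity is claimed only on the
span of the `V ^ p b`, where `V ^ N` is the identity. -/
theorem exists_dual_of_rank_eq {V : H₂ ≃ₗᵢ[ℂ] H₂} {b : H₂} {N : ℕ} (hN : 0 < N)
    (hVb : (V ^ N) b = b) (hb : LinearIndependent ℂ fun p : Fin N => (V ^ (p : ℕ)) b)
    {rbar : ℕ} (hrbar : rbar ∣ N) {s' : ℕ} {h : Fin s' → H₂}
    (hrank : (crossCovMatrix V b N rbar h).rank = N) :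
    ∃ d : Fin s' → H₂, (∀ j, d j ∈ closedSpan fun p : Fin N => (V ^ (p : ℕ)) b) ∧
      ∀ v ∈ closedSpan fun p : Fin N => (V ^ (p : ℕ)) b,
        ∑ k : Fin s' × Fin (N / rbar),
          inner ℂ ((V ^ ((rbar : ℤ) * ((k.2 : ℕ) : ℤ))) (h k.1)) v •
            (V ^ ((rbar : ℤ) * ((k.2 : ℕ) : ℤ))) (d k.1) = v := by
  obtain ⟨A, hA, hlow⟩ :=
    exists_lower_bound_of_finite ((rank_crossCovMatrix_eq_iff hVb hb rbar h).1 hrank)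
  have : NeZero (N / rbar) :=
    ⟨(Nat.div_pos (Nat.le_of_dvd hN hrbar) (Nat.pos_of_dvd_of_pos hrbar hN)).ne'⟩
  have hmem := fun (m : ℤ) u hu => zpow_apply_mem_closedSpan_fin (V := V) (u := u) hN hVb m hu
  have hadd : ∀ m n : Fin (N / rbar), ∀ u ∈ closedSpan fun p : Fin N => (V ^ (p : ℕ)) b,
      (V ^ ((rbar : ℤ) * (((m + n : Fin (N / rbar)) : ℕ) : ℤ))) u =
        (V ^ ((rbar : ℤ) * ((m : ℕ) : ℤ))) ((V ^ ((rbar : ℤ) * ((n : ℕ) : ℤ))) u) := by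
    intro m n u hu
    -- Wrapping around in `Fin (N / rbar)` changes the exponent by a multiple of `rbar * (N / rbar)
    -- = N`.
    have h1 : (rbar : ℤ) * (((m : ℕ) : ℤ) + ((n : ℕ) : ℤ)) =
        (rbar : ℤ) * (((m + n : Fin (N / rbar)) : ℕ) : ℤ) +
          (N : ℤ) * ((((m : ℕ) + (n : ℕ)) / (N / rbar) : ℕ) : ℤ) := by
      have h2 : (N : ℤ) = (rbar : ℤ) * ((N / rbar : ℕ) : ℤ) := by
        exact_mod_cast (Nat.mul_div_cancel' hrbar).symm
      have h3 := Nat.mod_add_div ((m : ℕ) + (n : ℕ)) (N / rbar)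
      rw [Fin.val_add]
      conv_rhs => rw [h2, mul_assoc, ← mul_add]
      congr 1
      exact_mod_cast h3.symm
    rw [← zpow_add_apply, ← mul_add, h1, zpow_add_apply, zpow_mul_apply_of_mem_closedSpan hVb _ hu]
  set g : Fin s' × Fin (N / rbar) → H₂ :=
    fun k => (V ^ ((rbar : ℤ) * ((k.2 : ℕ) : ℤ))) (h k.1)
  have hbes : ∀ v ∈ closedSpan fun p : Fin N => (V ^ (p : ℕ)) b,
      Summable (fun k => ‖inner ℂ (g k) v‖ ^ 2) ∧
        ∑' k, ‖inner ℂ (g k) v‖ ^ 2 ≤ (∑ k, ‖g k‖ ^ 2 + 1) * ‖v‖ ^ 2 := fun v _ => by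
    refine ⟨(hasSum_fintype _).summable, ?_⟩
    rw [tsum_fintype]
    exact (sum_norm_sq_inner_le g v).trans (by nlinarith [sq_nonneg ‖v‖])
  obtain ⟨d, hd, hsum, -⟩ := exists_dual_orbit (isClosed_closedSpan _)
    (fun m : Fin (N / rbar) => V ^ ((rbar : ℤ) * ((m : ℕ) : ℤ))) (fun m => hmem _)
    (fun m u hu => by rw [symm_zpow_apply]; exact hmem _ u hu) hadd h hA (by positivity)
    hbes (fun v hv => by rw [tsum_fintype]; exact hlow v hv)
  exact ⟨d, hd, fun v hv => (hasSum_fintype _).unique (hsum v hv)⟩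

end Duals

/-! ### Tensor frames and the equivalences -/

section Main

variable {H₁ H₂ : Type*} [NormedAddCommGroup H₁] [InnerProductSpace ℂ H₁]
  [NormedAddCommGroup H₂] [InnerProductSpace ℂ H₂]

theorem shiftOp_pureTensor (U : H₁ ≃ₗᵢ[ℂ] H₁) (V : H₂ ≃ₗᵢ[ℂ] H₂) (n m : ℤ) (u : H₁) (v : H₂) :
    shiftOp U V n m (pureTensor u v) = pureTensor ((U ^ n) u) ((V ^ m) v) :=
  tensorOp_pureTensor _ _ _ _

/-- Reordering of the index set of the samples. -/
def sampleIndexEquiv (s s' l : ℕ) :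
    Fin s × Fin s' × ℤ × Fin l ≃ (Fin s' × Fin l) × (Fin s × ℤ) where
  toFun i := ((i.2.1, i.2.2.2), (i.1, i.2.2.1))
  invFun p := (p.2.1, p.1.1, p.2.2, p.1.2)
  left_inv _ := rfl
  right_inv _ := rfl

/-- On elementary tensors the sample energy is a product of one energy per factor, so a lower bound
for it can be tested with one factor frozen. -/
theorem hasSum_norm_sq_inner_pureTensor {ι κ : Type*} [Fintype κ] {f : ι → H₁} (g : κ → H₂)
    {u : H₁} (v : H₂) (hf : Summable fun i => ‖inner ℂ (f i) u‖ ^ 2) :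
    HasSum (fun p : κ × ι => ‖inner ℂ (pureTensor (f p.2) (g p.1)) (pureTensor u v)‖ ^ 2)
      ((∑ k, ‖inner ℂ (g k) v‖ ^ 2) * ∑' i, ‖inner ℂ (f i) u‖ ^ 2) := by
  simp only [inner_pureTensor, norm_mul, mul_pow]
  rw [Finset.sum_mul]
  refine hasSum_prod_fintype (F := fun k i => ‖inner ℂ (f i) u‖ ^ 2 * ‖inner ℂ (g k) v‖ ^ 2)
    fun k => ?_
  rw [mul_comm]
  exact hf.hasSum.mul_right (‖inner ℂ (g k) v‖ ^ 2)

theorem IsRieszSequence.ne_zero {x : ℤ → H₁} (hx : IsRieszSequence x) (n : ℤ) : x n ≠ 0 := by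
  obtain ⟨Ψ, hΨ⟩ := hx.exists_equiv
  intro h0
  have h1 : Ψ (fourierLp 2 n) = 0 := Subtype.ext ((hΨ n).trans h0)
  rw [map_eq_zero_iff _ Ψ.injective] at h1
  have h2 := (orthonormal_fourier (T := (1 : ℝ))).1 n
  rw [h1, norm_zero] at h2
  exact zero_ne_one h2

/-- Tensor products of dual frames: if `f'` reconstructs the first factor from `f` and `g'`
reconstructs the second factor from `g`, then the tensor products `f' ⊗ g'` form a frame. -/
theorem isFrameFor_tensor [CompleteSpace H₁] {ι κ α β : Type*} [Fintype κ] {x : α → H₁} {y : β → H₂}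
    {f f' : ι → H₁} {g g' : κ → H₂} {B B' : ℝ} (hB : 0 ≤ B) (hB' : 0 ≤ B')
    (hf' : ∀ i, f' i ∈ closedSpan x) (hg' : ∀ k, g' k ∈ closedSpan y)
    (hbes : ∀ u ∈ closedSpan x, Summable (fun i => ‖inner ℂ (f i) u‖ ^ 2) ∧
      ∑' i, ‖inner ℂ (f i) u‖ ^ 2 ≤ B * ‖u‖ ^ 2)
    (hbes' : IsBessel f' B')
    (hf : ∀ u ∈ closedSpan x, HasSum (fun i => inner ℂ (f i) u • f' i) u)
    (hg : ∀ v ∈ closedSpan y, ∑ k, inner ℂ (g k) v • g' k = v) :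
    IsFrameFor (closedSpan fun q : α × β => pureTensor (x q.1) (y q.2))
      fun p : κ × ι => pureTensor (f' p.2) (g' p.1) := by
  refine isFrameFor_of_hasSum (f := fun p => pureTensor (f p.2) (g p.1))
    (B := B' * ∑ k, ‖g' k‖ ^ 2 + 1) (B' := B * ∑ k, ‖g k‖ ^ 2 + 1)
    (by positivity) (by positivity) (fun p => pureTensor_mem_closedSpan (hf' _) (hg' _))
    (fun z => ?_) (fun z hz => ?_) fun z hz => hasSum_tensor hf hg hz
  · have := bessel_tensor g' hB' (K := ⊤) (fun u _ => hbes' u) (z := z) fun _ => Submodule.mem_top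
    exact ⟨this.1, this.2.trans (by nlinarith [sq_nonneg ‖z‖])⟩
  · have := bessel_tensor g hB hbes fun k => adjoint_tensorRight_mem (g k) hz
    exact ⟨this.1, this.2.trans (by nlinarith [sq_nonneg ‖z‖])⟩

/-- A Bessel family that reconstructs a tensor product space from tensor samples forces both
factors of the sampling family to be bounded below. -/
theorem mul_norm_sq_le_of_reconstruction {ι κ ι' α β : Type*} [Fintype κ] {x : α → H₁} {y : β → H₂}
    {f : ι → H₁} {g : κ → H₂} (e : ι' ≃ κ × ι) {C : ι' → HilbertTensor H₁ H₂} {B : ℝ} (hB : 0 ≤ B)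
    (hC : ∀ z ∈ closedSpan fun q : α × β => pureTensor (x q.1) (y q.2),
      Summable (fun i => ‖inner ℂ (C i) z‖ ^ 2) ∧ ∑' i, ‖inner ℂ (C i) z‖ ^ 2 ≤ B * ‖z‖ ^ 2)
    (hrec : ∀ z ∈ closedSpan fun q : α × β => pureTensor (x q.1) (y q.2),
      HasSum (fun i => inner ℂ (pureTensor (f (e i).2) (g (e i).1)) z • C i) z)
    {u : H₁} (hu : u ∈ closedSpan x) {v : H₂} (hv : v ∈ closedSpan y)
    (hf : Summable fun i => ‖inner ℂ (f i) u‖ ^ 2) :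
    ‖u‖ ^ 2 * ‖v‖ ^ 2 ≤
      B * ((∑ k, ‖inner ℂ (g k) v‖ ^ 2) * ∑' i, ‖inner ℂ (f i) u‖ ^ 2) := by
  have hz := pureTensor_mem_closedSpan hu hv
  have h1 := e.hasSum_iff.2 (hasSum_norm_sq_inner_pureTensor g v hf)
  have h2 := norm_sq_le_mul_tsum hB (hrec _ hz) h1.summable (hC _ hz).1 (hC _ hz).2
  rw [norm_pureTensor, mul_pow] at h2
  exact h2.trans_eq (congrArg _ h1.tsum_eq)

/-- Frame reconstruction with product structure from a positive essential infimum and full rank. -/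
theorem exists_product_frame [CompleteSpace H₁] [CompleteSpace H₂] {U : H₁ ≃ₗᵢ[ℂ] H₁}
    {V : H₂ ≃ₗᵢ[ℂ] H₂} {a : H₁} {b : H₂} {N : ℕ} (hN : 0 < N)
    (ha : IsRieszSequence fun n : ℤ => (U ^ n) a) (hVb : (V ^ N) b = b)
    (hb : LinearIndependent ℂ fun p : Fin N => (V ^ (p : ℕ)) b) {r rbar : ℕ} (hr : 0 < r)
    (hrbar : rbar ∣ N) {s s' : ℕ} {h₁ : Fin s → H₁} {h₂ : Fin s' → H₂}
    (hg : ∀ j, MemLp (symbol U a (h₁ j)) ⊤ AddCircle.haarAddCircle)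
    (hα : 0 < alphaG r (fun j => symbol U a (h₁ j)))
    (hrank : (crossCovMatrix V b N rbar h₂).rank = N) :
    ∃ (c : Fin s → H₁) (d : Fin s' → H₂),
      (∀ j j', pureTensor (c j) (d j') ∈ sampledSpace U V a b N) ∧
      IsFrameFor (sampledSpace U V a b N)
        (fun i : Fin s × Fin s' × ℤ × Fin (N / rbar) =>
          shiftOp U V (r * i.2.2.1) (rbar * ((i.2.2.2 : ℕ) : ℤ))
            (pureTensor (c i.1) (d i.2.1))) ∧
      ∀ x ∈ sampledSpace U V a b N,
        HasSum (fun i : Fin s × Fin s' × ℤ × Fin (N / rbar) =>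
          sample U V (h₁ i.1) (h₂ i.2.1) x (r * i.2.2.1) (rbar * ((i.2.2.2 : ℕ) : ℤ)) •
            shiftOp U V (r * i.2.2.1) (rbar * ((i.2.2.2 : ℕ) : ℤ))
              (pureTensor (c i.1) (d i.2.1))) x := by
  obtain ⟨B, hB, hbes⟩ := exists_bessel_bound_samples ha hr hg
  obtain ⟨c, hc, hcsum, B', hB', hcbes⟩ := exists_dual_of_alphaG_pos ha hr hg hα
  obtain ⟨d, hd, hdsum⟩ := exists_dual_of_rank_eq hN hVb hb hrbar hrank
  have hmem : ∀ (m : ℤ) j, (U ^ m) (c j) ∈ closedSpan fun n : ℤ => (U ^ n) a := fun m j =>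
    zpow_apply_mem_closedSpan (fun m n => (zpow_add_apply U m n a).symm) m (hc j)
  have hmem' : ∀ (m : ℤ) j, (V ^ m) (d j) ∈ closedSpan fun p : Fin N => (V ^ (p : ℕ)) b :=
    fun m j => zpow_apply_mem_closedSpan_fin hN hVb m (hd j)
  refine ⟨c, d, fun j j' => ?_, ?_, fun x hx => ?_⟩
  · exact pureTensor_mem_closedSpan (x := fun n : ℤ => (U ^ n) a)
      (y := fun p : Fin N => (V ^ (p : ℕ)) b) (hc j) (hd j')
  · simp only [shiftOp_pureTensor]
    have h1 := (isFrameFor_tensor hB.le hB'.le (fun p => hmem _ _) (fun k => hmem' _ _)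
      hbes hcbes hcsum hdsum).comp_equiv (sampleIndexEquiv s s' (N / rbar))
    exact h1
  · simp only [shiftOp_pureTensor]
    have h1 := (sampleIndexEquiv s s' (N / rbar)).hasSum_iff.2 (hasSum_tensor hcsum hdsum hx)
    exact h1

/-- Any frame reconstruction from the samples forces a positive essential infimum and full rank. -/
theorem alphaG_pos_and_rank_eq_of_reconstruction [CompleteSpace H₁] [CompleteSpace H₂] {U : H₁ ≃ₗᵢ[ℂ] H₁}
    {V : H₂ ≃ₗᵢ[ℂ] H₂} {a : H₁} {b : H₂} {N : ℕ} (hN : 0 < N)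
    (ha : IsRieszSequence fun n : ℤ => (U ^ n) a) (hVb : (V ^ N) b = b)
    (hb : LinearIndependent ℂ fun p : Fin N => (V ^ (p : ℕ)) b) {r rbar : ℕ} (hr : 0 < r)
    {s s' : ℕ} {h₁ : Fin s → H₁} {h₂ : Fin s' → H₂}
    (hg : ∀ j, MemLp (symbol U a (h₁ j)) ⊤ AddCircle.haarAddCircle)
    {C : Fin s × Fin s' × ℤ × Fin (N / rbar) → HilbertTensor H₁ H₂}
    (hC : IsFrameFor (sampledSpace U V a b N) C)
    (hrec : ∀ x ∈ sampledSpace U V a b N,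
      HasSum (fun i : Fin s × Fin s' × ℤ × Fin (N / rbar) =>
        sample U V (h₁ i.1) (h₂ i.2.1) x (r * i.2.2.1) (rbar * ((i.2.2.2 : ℕ) : ℤ)) • C i) x) :
    0 < alphaG r (fun j => symbol U a (h₁ j)) ∧ (crossCovMatrix V b N rbar h₂).rank = N := by
  obtain ⟨B, hB, hbes⟩ := exists_bessel_bound_samples ha hr hg
  set f : Fin s × ℤ → H₁ := fun p => (U ^ ((r : ℤ) * p.2)) (h₁ p.1)
  set g : Fin s' × Fin (N / rbar) → H₂ :=
    fun k => (V ^ ((rbar : ℤ) * ((k.2 : ℕ) : ℤ))) (h₂ k.1)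
  obtain ⟨-, A, M, -, hM, hC⟩ := hC
  have key : ∀ u ∈ closedSpan (fun n : ℤ => (U ^ n) a),
      ∀ v ∈ closedSpan (fun p : Fin N => (V ^ (p : ℕ)) b),
      ‖u‖ ^ 2 * ‖v‖ ^ 2 ≤
        M * ((∑ k, ‖inner ℂ (g k) v‖ ^ 2) * ∑' i, ‖inner ℂ (f i) u‖ ^ 2) := by
    intro u hu v hv
    refine mul_norm_sq_le_of_reconstruction (x := fun n : ℤ => (U ^ n) a)
      (y := fun p : Fin N => (V ^ (p : ℕ)) b) (g := g) (f := f) (C := C)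
      (sampleIndexEquiv s s' (N / rbar)) hM.le ?_ ?_ hu hv (hbes u hu).1
    · exact fun z hz => ⟨(hC z hz).1, (hC z hz).2.2⟩
    · exact fun z hz => hrec z hz
  have ha0 : a ≠ 0 := by simpa using ha.ne_zero 0
  have hb0 : b ≠ 0 := by simpa using hb.ne_zero ⟨0, hN⟩
  have ha' : a ∈ closedSpan fun n : ℤ => (U ^ n) a := by
    simpa using mem_closedSpan (fun n : ℤ => (U ^ n) a) 0
  have hb' : b ∈ closedSpan fun p : Fin N => (V ^ (p : ℕ)) b := by
    simpa using mem_closedSpan (fun p : Fin N => (V ^ (p : ℕ)) b) ⟨0, hN⟩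
  constructor
  · set G := ∑ k, ‖g k‖ ^ 2 + 1 with hG
    have hG0 : 0 < G := by positivity
    refine (alphaG_pos_iff_exists_lower_bound ha hr hg).2
      ⟨(M * G)⁻¹, by positivity, fun u hu => ?_⟩
    have hb2 : 0 < ‖b‖ ^ 2 := by positivity
    have h0 : 0 ≤ ∑' i, ‖inner ℂ (f i) u‖ ^ 2 := tsum_nonneg fun _ => by positivity
    have h1 : ∑ k, ‖inner ℂ (g k) b‖ ^ 2 ≤ G * ‖b‖ ^ 2 :=
      (sum_norm_sq_inner_le g b).trans (by rw [hG]; nlinarith)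
    rw [inv_mul_le_iff₀ (by positivity)]
    -- Freezing the second factor at `b ≠ 0` leaves a lower bound for the first.
    refine le_of_mul_le_mul_right ((key u hu b hb').trans ?_) hb2
    calc M * ((∑ k, ‖inner ℂ (g k) b‖ ^ 2) * ∑' i, ‖inner ℂ (f i) u‖ ^ 2)
        ≤ M * ((G * ‖b‖ ^ 2) * ∑' i, ‖inner ℂ (f i) u‖ ^ 2) := by gcongr
      _ = M * G * (∑' i, ‖inner ℂ (f i) u‖ ^ 2) * ‖b‖ ^ 2 := by ring
  · rw [rank_crossCovMatrix_eq_iff hVb hb]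
    intro v hv h0
    -- Freezing the first factor at `a ≠ 0`: a vector `v` with vanishing samples has `‖a‖² ‖v‖² ≤
    -- 0`.
    have h1 := key a ha' v hv
    have h2 : ∑ k, ‖inner ℂ (g k) v‖ ^ 2 = 0 :=
      Finset.sum_eq_zero fun k _ => by rw [h0 k]; simp
    rw [h2, zero_mul, mul_zero] at h1
    by_contra hv0
    have : 0 < ‖a‖ ^ 2 * ‖v‖ ^ 2 := by positivity
    exact absurd h1 (not_le.2 this)

end Main

end TensorSampling

open TensorSampling
theorem mainTheorem1
    {H₁ H₂ : Type*}
    [NormedAddCommGroup H₁] [InnerProductSpace ℂ H₁] [CompleteSpace H₁]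
    [TopologicalSpace.SeparableSpace H₁]
    [NormedAddCommGroup H₂] [InnerProductSpace ℂ H₂] [CompleteSpace H₂]
    [TopologicalSpace.SeparableSpace H₂]
    (U : H₁ ≃ₗᵢ[ℂ] H₁) (V : H₂ ≃ₗᵢ[ℂ] H₂) (a : H₁) (b : H₂) (N : ℕ) (hN : 0 < N)
    (ha : IsRieszSequence fun n : ℤ => (U ^ n) a)
    (hVb : (V ^ N) b = b)
    (hb : LinearIndependent ℂ fun p : Fin N => (V ^ (p : ℕ)) b)
    (r rbar : ℕ) (hr : 0 < r) (hrbar : rbar ∣ N)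
    (s s' : ℕ) (h₁ : Fin s → H₁) (h₂ : Fin s' → H₂) :
    ((∀ j, MemLp (symbol U a (h₁ j)) ⊤ AddCircle.haarAddCircle) ↔
        betaG r (fun j => symbol U a (h₁ j)) < ⊤) ∧
    ((∀ j, MemLp (symbol U a (h₁ j)) ⊤ AddCircle.haarAddCircle) →
      List.TFAE [
        -- (a)
        0 < alphaG r (fun j => symbol U a (h₁ j)) ∧ (crossCovMatrix V b N rbar h₂).rank = N,
        -- (b)
        ∃ (c : Fin s → H₁) (d : Fin s' → H₂),
          (∀ j j', pureTensor (c j) (d j') ∈ sampledSpace U V a b N) ∧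
          IsFrameFor (sampledSpace U V a b N)
            (fun i : Fin s × Fin s' × ℤ × Fin (N / rbar) =>
              shiftOp U V (r * i.2.2.1) (rbar * ((i.2.2.2 : ℕ) : ℤ))
                (pureTensor (c i.1) (d i.2.1))) ∧
          ∀ x ∈ sampledSpace U V a b N,
            HasSum (fun i : Fin s × Fin s' × ℤ × Fin (N / rbar) =>
              sample U V (h₁ i.1) (h₂ i.2.1) x (r * i.2.2.1) (rbar * ((i.2.2.2 : ℕ) : ℤ)) •
                shiftOp U V (r * i.2.2.1) (rbar * ((i.2.2.2 : ℕ) : ℤ))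
                  (pureTensor (c i.1) (d i.2.1))) x,
        -- (c)
        ∃ C : Fin s × Fin s' × ℤ × Fin (N / rbar) → HilbertTensor H₁ H₂,
          IsFrameFor (sampledSpace U V a b N) C ∧
          ∀ x ∈ sampledSpace U V a b N,
            HasSum (fun i : Fin s × Fin s' × ℤ × Fin (N / rbar) =>
              sample U V (h₁ i.1) (h₂ i.2.1) x (r * i.2.2.1) (rbar * ((i.2.2.2 : ℕ) : ℤ)) •
                C i) x]) := by
  refine ⟨memLp_top_iff_betaG_lt_top _ hr, fun hg => ?_⟩
  tfae_have 1 → 2 := fun ⟨hα, hrank⟩ => exists_product_frame hN ha hVb hb hr hrbar hg hα hrank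
  tfae_have 2 → 3 := fun ⟨c, d, _, hframe, hsum⟩ => ⟨_, hframe, hsum⟩
  tfae_have 3 → 1 := fun ⟨C, hC, hrec⟩ =>
    alphaG_pos_and_rank_eq_of_reconstruction hN ha hVb hb hr hg hC hrec
  tfae_finish
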